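/- **Conventions.** For all $d\geq 0$, $\mathbb{R}^d$ carries the $\ell^\infty$ norm; linear and multilinear maps carry the corresponding operator norms, and $B(x,r)$ is the open ball. Let $m\in\mathbb{N}$, $\varepsilon\in(0,1]$, let $E,F$ be normed spaces and $S\subseteq E$. A map $f:S\to F$ is $\mathrm{Lip}\text{-}(m+\varepsilon)$ if there are a constant $M\ge 0$, maps $f^0=f,f^1,\dots,f^m$ on $S$, where $f^j(x)$ is a symmetric $j$-linear map from $E$ to $F$, and $j$-linear maps $R_j(x,y)$, such that for all $0\le j\le m$, $x,y\in S$ and $v\in E^{j}$ $$\|f^j(x)\|\le M,\qquad f^j(x)(v)=\sum_{l=j}^m \frac{1}{(l-j)!}f^l(y)\bigl(v,\underbrace{x-y,\dots,x-y}_{l-j}\bigr)+R_j(x,y)(v),\qquad \|R_j(x,y)\|\le M\|x-y\|^{m+\varepsilon-j}.$$ The smallest such $M$ is the norm $\|f\|_{\mathrm{Lip}\text{-}(m+\varepsilon)}$. (If $S$ is open, then $f^1,\dots,f^m$ are the derivatives of $f$.) A $\mathrm{Lip}\text{-}(m+\varepsilon)$ diffeomorphism is a $\mathrm{Lip}\text{-}(m+\varepsilon)$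 bijection whose inverse is $\mathrm{Lip}\text{-}(m+\varepsilon)$. **Theorem (Constant Rank).** Let $n\ge 1$ be an integer, $\varepsilon\in(0,1]$ and $M_1,M_2>0$. There exist constants $\delta>0$ and $c>0$, depending only on $n,\varepsilon,M_1,M_2$, with the following property. Let $p,q\ge 1$ and $k\ge 0$ be integers, $U\subseteq\mathbb{R}^p$ open, and $\varphi=(\varphi_1,\dots,\varphi_q):U\to\mathbb{R}^q$ a differentiable map whose derivative $\mathrm{d}\varphi(x)$ has rank $k$ at every $x\in U$, such that $\mathrm{d}\varphi$ is $\mathrm{Lip}\text{-}(n+\varepsilon-1)$ on $U$ with $\|\mathrm{d}\varphi\|_{\mathrm{Lip}\text{-}(n+\varepsilon-1)}\le M_1$. Let $x_0\in U$, $1\le i_1<\dots<i_k\le q$ and $1\le j_1<\dots<j_k\le p$ be such that $M=\bigl(\frac{\partial\varphi_{i_r}}{\partial x_{j_l}}(x_0)\bigr)_{1\le r,l\le k}$ is invertible with $\|M^{-1}\|\le M_2$. Then for every $\alpha\in(0,\delta]$ with $\overline{B(x_0,\alpha)}\subseteq U$ there are - open sets $U_0,H\subseteq\mathbb{R}^p$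 with $B(x_0,\alpha/3)\subseteq U_0\subseteq U$ and a $\mathrm{Lip}\text{-}(n+\varepsilon)$ diffeomorphism $f:U_0\to H$ with $f(x_0)=0$; - an open set $W\subseteq\mathbb{R}^q$ containing $\varphi(U_0)$ and a $\mathcal{C}^n$ diffeomorphism $g$ from $W$ onto an open subset of $\mathbb{R}^q$ with $g(\varphi(x_0))=0$, such that $\mathrm{d}g$ is $\mathrm{Lip}\text{-}(n+\varepsilon-1)$ on $W$ and the restriction of $g$ to $\varphi(U_0)$, and to any bounded subset of $W$, is $\mathrm{Lip}\text{-}(n+\varepsilon)$; such that for all $x=(x_1,\dots,x_p)\in H$ $$g\circ\varphi\circ f^{-1}(x_1,\dots,x_p)=(x_1,\dots,x_k,0,\dots,0)\in\mathbb{R}^q.$$ Moreover, if $k=p$, then $\varphi|_{U_0}$ is injective, $\mathrm{d}\varphi(x)$ is injective for every $x\in U_0$, and there is a differentiable map $\hat\varphi:V\to\mathbb{R}^p$ on an open set $V\supseteq\varphi(U_0)$ with $\hat\varphi(\varphi(x))=x$ for all $x\in U_0$, which is $\mathrm{Lip}\text{-}(n+\varepsilon)$ on $V$, and whose derivative is $\mathrm{Lip}\text{-}(n+\varepsilon-1)$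 on $V$ with $$\|\mathrm{d}\hat\varphi\|_{\mathrm{Lip}\text{-}(n+\varepsilon-1)}\le c\,\|\mathrm{d}\varphi\|_{\mathrm{Lip}\text{-}(n+\varepsilon-1)},$$ where the norms are taken on $V$ and on $U$ respectively. -/

import Mathlib

section LipschitzMaps

variable {E F : Type*} [NormedAddCommGroup E] [NormedSpace ℝ E]
  [NormedAddCommGroup F] [NormedSpace ℝ F]

/-- The tuple `(v₁, …, v_k, h, …, h)` of length `j`, standing for the elementary tensor
`v ⊗ h^{⊗ (j - k)}` with `v = v₁ ⊗ ⋯ ⊗ v_k` (used for `k ≤ j` only). -/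
def padTuple {k : ℕ} (j : ℕ) (v : Fin k → E) (h : E) : Fin j → E :=
  fun i => if hi : i.1 < k then v ⟨i.1, hi⟩ else h

/-- The collection `(J · 0, …, J · n)` of maps with values in the symmetric `k`-linear maps is
Lipschitz of degree `n + ε` on `S` with constant `M`. A `k`-linear map carries its operator norm.
Only the terms of order `k ≤ n` at the points of `S` matter. -/
structure IsLipJet (n : ℕ) (ε M : ℝ) (J : E → FormalMultilinearSeries ℝ E F) (S : Set E) :
    Prop where
  symm : ∀ k ≤ n, ∀ x ∈ S, ∀ (σ : Equiv.Perm (Fin k)) (v : Fin k → E),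
    J x k (fun i => v (σ i)) = J x k v
  bound : ∀ k ≤ n, ∀ x ∈ S, ‖J x k‖ ≤ M
  taylor : ∃ R : E → E → FormalMultilinearSeries ℝ E F, ∀ k ≤ n, ∀ x ∈ S, ∀ y ∈ S,
    (∀ v : Fin k → E, J x k v =
      (∑ j ∈ Finset.Icc k n, ((j - k).factorial : ℝ)⁻¹ • J y j (padTuple j v (x - y)))
        + R x y k v) ∧
    ‖R x y k‖ ≤ M * ‖x - y‖ ^ ((n : ℝ) + ε - (k : ℝ))

/-- `f` is the zeroth term of some Lipschitz collection of degree `n + ε` on `S`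
with constant `M`. -/
def IsLipWith (n : ℕ) (ε M : ℝ) (f : E → F) (S : Set E) : Prop :=
  ∃ J : E → FormalMultilinearSeries ℝ E F,
    (∀ x ∈ S, (J x 0).curry0 = f x) ∧ IsLipJet n ε M J S

/-- `f` is `Lip-(n + ε)` on `S`. -/
def IsLip (n : ℕ) (ε : ℝ) (f : E → F) (S : Set E) : Prop :=
  ∃ M : ℝ, IsLipWith n ε M f S

/-- The `Lip-(n + ε)` norm of `f` on `S`, the smallest admissible constant (meaningful when `f`
is `Lip-(n + ε)` on `S`). On an open set the higher order terms are the derivatives of `f`, so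
that there is only one collection to consider. -/
noncomputable def lipNorm (n : ℕ) (ε : ℝ) (f : E → F) (S : Set E) : ℝ :=
  sInf {M : ℝ | 0 ≤ M ∧ IsLipWith n ε M f S}

/-- `f : U → V` is a bijection with inverse `f' : V → U`, and both are `Lip-(n + ε)`. -/
structure IsLipDiffeo (n : ℕ) (ε : ℝ) (f : E → F) (f' : F → E) (U : Set E) (V : Set F) :
    Prop where
  mapsTo : Set.MapsTo f U V
  mapsTo_inv : Set.MapsTo f' V U
  invOn : Set.InvOn f' f U V
  lip : IsLip n ε f U
  lip_inv : IsLip n ε f' V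

/-- `f : U → V` is a diffeomorphism of class `C^n` between open sets, with inverse `f'`. -/
structure IsDiffeo (n : ℕ) (f : E → F) (f' : F → E) (U : Set E) (V : Set F) : Prop where
  isOpen_source : IsOpen U
  isOpen_target : IsOpen V
  mapsTo : Set.MapsTo f U V
  mapsTo_inv : Set.MapsTo f' V U
  invOn : Set.InvOn f' f U V
  contDiffOn : ContDiffOn ℝ (n : WithTop ℕ∞) f U
  contDiffOn_inv : ContDiffOn ℝ (n : WithTop ℕ∞) f' V

end LipschitzMaps

/-- The minor `(∂φ_{i_r} / ∂x_{j_l} (x))_{r, l}`. The spaces `Fin p → ℝ` carry the sup norm. -/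
noncomputable def jacobianMinor {p q k : ℕ} (φ : (Fin p → ℝ) → (Fin q → ℝ)) (x : Fin p → ℝ)
    (i : Fin k → Fin q) (j : Fin k → Fin p) : Matrix (Fin k) (Fin k) ℝ :=
  Matrix.of fun r l => fderiv ℝ φ x (Pi.single (j l) 1) (i r)

/-- The norm of a square matrix subordinate to the sup norm. -/
noncomputable def subordinateNorm {k : ℕ} (A : Matrix (Fin k) (Fin k) ℝ) : ℝ :=
  ‖LinearMap.toContinuousLinearMap (Matrix.toLin' A)‖

/-- The map `(x₁, …, x_p) ↦ (x₁, …, x_k, 0, …, 0)` from `ℝ^p` to `ℝ^q`, for `k ≤ p` and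
`k ≤ q`. -/
def firstCoords (p q k : ℕ) (x : Fin p → ℝ) : Fin q → ℝ :=
  fun i => if h : i.1 < k ∧ i.1 < p then x ⟨i.1, h.2⟩ else 0

-- Let `u` collect the `k` components of `φ` selected by the minor. Replacing the `k` selected
-- coordinates of `x - x₀` by `u x - u x₀` gives a map `f` whose derivative `L` at `x₀` is block
-- triangular with the minor as a diagonal block; so `L` is invertible, with a bound on its inverse
-- in terms of `M₁` and `M₂`. By Hölder continuity `L⁻¹ ∘ f` has derivative within 1/4 of the
-- identity on balls of radius at most `δ`, hence is inverted on balls of explicit size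
-- (`exists_local_inverse`, `exists_straightening`). In the new coordinates, `Φ = φ ∘ f⁻¹` has `u x₀
-- + π y` as its selected block, `π` being the projection on the first `k` coordinates. This block
-- already accounts for the whole rank, so `dΦ` vanishes on the kernel of `π`. On a convex domain
-- `Φ` is therefore constant along the fibres of `π` and descends to `Ψ` with `Φ = Ψ ∘ π`
-- (`eq_of_proj_eq`, `exists_descent`). The image of `φ` is thus a graph, which the shear `flatten`
-- straightens. If `k = p`, nothing is lost under `π`, and `f⁻¹` applied to the selected components
-- is a left inverse of `φ`. Its derivative has an absolute bound, which is turned into a multiple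
-- of the norm of `dφ` by `1 ≤ M₂ * ‖dφ(x₀)‖`. Jets are awkward to compose and to invert. They are
-- replaced by `HolderClass`, a recursion on derivatives, equivalent to the jet definition on open
-- convex sets with the same constant (`HolderClass.isLipWith`, `IsLipWith.holderClass`). Its
-- stability under bilinear maps, composition and inversion comes with constants that ignore the
-- spaces. Coordinate permutations, projections and inclusions have norm at most 1 for the sup
-- norms, so `δ` and `c` do not depend on `p`, `q`, `k`.

universe u

/-- `f` is `m` times differentiable on `S` (meant to be open), `f` and its derivatives up to order
`m` are bounded by `C`, and the derivative of order `m` is `ε`-Hölder with constant `C`. -/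
def HolderClass (ε C : ℝ) {E : Type u} [NormedAddCommGroup E] [NormedSpace ℝ E] :
    ℕ → ∀ {F : Type u} [NormedAddCommGroup F] [NormedSpace ℝ F], (E → F) → Set E → Prop
  | 0, _, _, _, f, S => (∀ x ∈ S, ‖f x‖ ≤ C) ∧ ∀ x ∈ S, ∀ y ∈ S, ‖f x - f y‖ ≤ C * ‖x - y‖ ^ ε
  | m + 1, _, _, _, f, S => (∀ x ∈ S, ‖f x‖ ≤ C) ∧ DifferentiableOn ℝ f S ∧
      HolderClass ε C m (fderiv ℝ f) S

/-- `f` is `C`-Lipschitz on `S` and, if `m > 0`, its derivative is of Hölder class `m - 1`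
with constant `C`. In contrast with `HolderClass`, nothing is assumed about the size of `f`. -/
def LipClass (ε C : ℝ) {E : Type u} [NormedAddCommGroup E] [NormedSpace ℝ E]
    {F : Type u} [NormedAddCommGroup F] [NormedSpace ℝ F] (m : ℕ) (f : E → F) (S : Set E) : Prop :=
  (∀ x ∈ S, ∀ y ∈ S, ‖f x - f y‖ ≤ C * ‖x - y‖) ∧
    ∀ l, m = l + 1 → DifferentiableOn ℝ f S ∧ HolderClass ε C l (fderiv ℝ f) S

/-! ### Calculus of Hölder classes with constants independent of the spaces. -/

section Calculus

variable {E : Type u} [NormedAddCommGroup E] [NormedSpace ℝ E]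
  {ε C C' : ℝ} {m : ℕ} {S S' : Set E}

theorem HolderClass.norm_le {F : Type u} [NormedAddCommGroup F] [NormedSpace ℝ F] {f : E → F}
    (h : HolderClass ε C m f S) : ∀ x ∈ S, ‖f x‖ ≤ C := by
  cases m with
  | zero => exact h.1
  | succ m => exact h.1

theorem HolderClass.mono_const (hC : C ≤ C') {F : Type u} [NormedAddCommGroup F] [NormedSpace ℝ F]
    {f : E → F} (h : HolderClass ε C m f S) : HolderClass ε C' m f S := by
  induction m generalizing F with
  | zero =>
    exact ⟨fun x hx => (h.1 x hx).trans hC, fun x hx y hy => (h.2 x hx y hy).trans (by gcongr)⟩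
  | succ m ih => exact ⟨fun x hx => (h.1 x hx).trans hC, h.2.1, ih h.2.2⟩

theorem HolderClass.mono_set (hS : S' ⊆ S) {F : Type u} [NormedAddCommGroup F] [NormedSpace ℝ F]
    {f : E → F} (h : HolderClass ε C m f S) : HolderClass ε C m f S' := by
  induction m generalizing F with
  | zero => exact ⟨fun x hx => h.1 x (hS hx), fun x hx y hy => h.2 x (hS hx) y (hS hy)⟩
  | succ m ih => exact ⟨fun x hx => h.1 x (hS hx), h.2.1.mono hS, ih h.2.2⟩

theorem HolderClass.congr (hS : IsOpen S) {F : Type u} [NormedAddCommGroup F] [NormedSpace ℝ F]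
    {f g : E → F} (h : HolderClass ε C m f S) (hfg : ∀ x ∈ S, g x = f x) :
    HolderClass ε C m g S := by
  induction m generalizing F with
  | zero =>
    refine ⟨fun x hx => hfg x hx ▸ h.1 x hx, fun x hx y hy => ?_⟩
    rw [hfg x hx, hfg y hy]
    exact h.2 x hx y hy
  | succ m ih =>
    refine ⟨fun x hx => hfg x hx ▸ h.1 x hx, h.2.1.congr hfg, ih h.2.2 fun x hx => ?_⟩
    exact Filter.EventuallyEq.fderiv_eq (Filter.eventuallyEq_of_mem (hS.mem_nhds hx) hfg)

theorem HolderClass.contDiffOn (hε : 0 < ε) (hS : IsOpen S) {F : Type u} [NormedAddCommGroup F]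
    [NormedSpace ℝ F] {f : E → F} (h : HolderClass ε C m f S) :
    ContDiffOn ℝ (m : WithTop ℕ∞) f S := by
  induction m generalizing F with
  | zero =>
    simp only [Nat.cast_zero, contDiffOn_zero]
    intro x hx
    rw [ContinuousWithinAt, tendsto_iff_norm_sub_tendsto_zero]
    have : Filter.Tendsto (fun y => C * ‖y - x‖ ^ ε) (nhdsWithin x S) (nhds 0) := by
      have h1 : Continuous fun y : E => C * ‖y - x‖ ^ ε :=
        continuous_const.mul ((continuous_id.sub continuous_const).norm.rpow_const
          fun _ => Or.inr hε.le)
      have h2 := (h1.tendsto x).mono_left (nhdsWithin_le_nhds (s := S))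
      simpa [Real.zero_rpow hε.ne'] using h2
    exact squeeze_zero' (Filter.Eventually.of_forall fun _ => norm_nonneg _)
      (Filter.eventually_of_mem self_mem_nhdsWithin fun y hy => h.2 y hy x hx) this
  | succ m ih =>
    rw [Nat.cast_add, Nat.cast_one, contDiffOn_succ_iff_fderiv_of_isOpen hS]
    exact ⟨h.2.1, fun h => absurd h (by simp), ih h.2.2⟩

theorem HolderClass.const (hC : 0 ≤ C) {F : Type u} [NormedAddCommGroup F] [NormedSpace ℝ F]
    (c : F) (hc : ‖c‖ ≤ C) : HolderClass ε C m (fun _ : E => c) S := by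
  induction m generalizing F with
  | zero =>
    exact ⟨fun x _ => hc, fun x _ y _ => by simpa using by positivity⟩
  | succ m ih =>
    refine ⟨fun x _ => hc, differentiableOn_const c, ?_⟩
    have : fderiv ℝ (fun _ : E => c) = fun _ => 0 := by ext1 x; simp
    rw [this]
    exact ih 0 (by simpa)

theorem HolderClass.add (hS : IsOpen S) {F : Type u} [NormedAddCommGroup F] [NormedSpace ℝ F]
    {f g : E → F} (hf : HolderClass ε C m f S) (hg : HolderClass ε C' m g S) :
    HolderClass ε (C + C') m (fun x => f x + g x) S := by
  induction m generalizing F with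
  | zero =>
    refine ⟨fun x hx => (norm_add_le _ _).trans (add_le_add (hf.1 x hx) (hg.1 x hx)),
      fun x hx y hy => ?_⟩
    rw [add_sub_add_comm, add_mul]
    exact (norm_add_le _ _).trans (add_le_add (hf.2 x hx y hy) (hg.2 x hx y hy))
  | succ m ih =>
    refine ⟨fun x hx => (norm_add_le _ _).trans (add_le_add (hf.1 x hx) (hg.1 x hx)),
      hf.2.1.add hg.2.1, (ih hf.2.2 hg.2.2).congr hS fun x hx => ?_⟩
    exact fderiv_fun_add ((hf.2.1 x hx).differentiableAt (hS.mem_nhds hx))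
      ((hg.2.1 x hx).differentiableAt (hS.mem_nhds hx))

theorem HolderClass.neg (hS : IsOpen S) {F : Type u} [NormedAddCommGroup F] [NormedSpace ℝ F]
    {f : E → F} (hf : HolderClass ε C m f S) : HolderClass ε C m (fun x => -f x) S := by
  induction m generalizing F with
  | zero =>
    refine ⟨fun x hx => by simpa using hf.1 x hx, fun x hx y hy => ?_⟩
    rw [← neg_sub_neg, neg_neg, neg_neg, norm_sub_rev]
    simpa [norm_sub_rev] using hf.2 x hx y hy
  | succ m ih =>
    refine ⟨fun x hx => by simpa using hf.1 x hx, hf.2.1.neg, (ih hf.2.2).congr hS fun x hx => ?_⟩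
    exact fderiv_fun_neg

theorem ContinuousLinearMap.norm_compL_apply_le (E : Type*) [NormedAddCommGroup E]
    [NormedSpace ℝ E] {F G : Type*} [NormedAddCommGroup F] [NormedSpace ℝ F]
    [NormedAddCommGroup G] [NormedSpace ℝ G] (A : F →L[ℝ] G) :
    ‖ContinuousLinearMap.compL ℝ E F G A‖ ≤ ‖A‖ :=
  ContinuousLinearMap.opNorm_le_bound _ (norm_nonneg _) fun B => A.opNorm_comp_le B

/-- The derivative of `A ∘ f` is post-composition by `A` applied to `fderiv ℝ f`; since
post-composition has norm at most `‖A‖`, the factor `K` does not grow with `m`. -/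
theorem HolderClass.clm_comp (hS : IsOpen S) {F G : Type u} [NormedAddCommGroup F]
    [NormedSpace ℝ F] [NormedAddCommGroup G] [NormedSpace ℝ G] {f : E → F}
    (hf : HolderClass ε C m f S) {K : ℝ} (A : F →L[ℝ] G) (hA : ‖A‖ ≤ K) :
    HolderClass ε (K * C) m (fun x => A (f x)) S := by
  induction m generalizing F G with
  | zero =>
    refine ⟨fun x hx => A.le_of_opNorm_le_of_le hA (hf.1 x hx), fun x hx y hy => ?_⟩
    rw [← map_sub, mul_assoc]
    exact A.le_of_opNorm_le_of_le hA (hf.2 x hx y hy)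
  | succ m ih =>
    refine ⟨fun x hx => A.le_of_opNorm_le_of_le hA (hf.1 x hx),
      A.differentiable.comp_differentiableOn hf.2.1, ?_⟩
    refine (ih hf.2.2 (ContinuousLinearMap.compL ℝ E F G A)
      ((A.norm_compL_apply_le E).trans hA)).congr hS fun x hx => ?_
    have := (A.hasFDerivAt (x := f x)).comp x
      ((hf.2.1 x hx).differentiableAt (hS.mem_nhds hx)).hasFDerivAt
    exact this.fderiv

/-- Interpolation between a Lipschitz bound and a sup bound: `d ≤ d ^ ε` for small `d`, and `1 ≤ d ^
ε` for large `d`. -/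
theorem norm_le_rpow_of_le_of_le {a b d : ℝ} (hε₀ : 0 < ε) (hε₁ : ε ≤ 1) (hC : 0 ≤ C) (hd : 0 ≤ d)
    (h₁ : a ≤ C * d) (h₂ : a ≤ b) (hb : b = 2 * C) : a ≤ b * d ^ ε := by
  subst hb
  rcases le_total d 1 with h | h
  · have : d ≤ d ^ ε := Real.self_le_rpow_of_le_one hd h hε₁
    nlinarith [mul_le_mul_of_nonneg_left this hC, mul_nonneg hC (Real.rpow_nonneg hd ε)]
  · have : 1 ≤ d ^ ε := Real.one_le_rpow h hε₀.le
    nlinarith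

/-- On an open convex set, one derivative may be forgotten. -/
theorem HolderClass.of_succ (hε₀ : 0 < ε) (hε₁ : ε ≤ 1) (hS : IsOpen S) (hconv : Convex ℝ S)
    {F : Type u} [NormedAddCommGroup F] [NormedSpace ℝ F] {f : E → F}
    (h : HolderClass ε C (m + 1) f S) : HolderClass ε (2 * C) m f S := by
  have h2 : ∀ x ∈ S, ‖f x‖ ≤ 2 * C := fun x hx => by
    linarith [h.1 x hx, norm_nonneg (f x)]
  induction m generalizing F with
  | zero =>
    refine ⟨h2, fun x hx y hy => ?_⟩
    have hC : 0 ≤ C := (norm_nonneg _).trans (h.1 x hx)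
    refine norm_le_rpow_of_le_of_le hε₀ hε₁ hC (norm_nonneg _) ?_ ?_ rfl
    · exact hconv.norm_image_sub_le_of_norm_fderiv_le
        (fun z hz => (h.2.1 z hz).differentiableAt (hS.mem_nhds hz)) (fun z hz => h.2.2.1 z hz) hy hx
    · linarith [norm_sub_le (f x) (f y), h.1 x hx, h.1 y hy]
  | succ m ih =>
    refine ⟨h2, h.2.1, ih h.2.2 fun x hx => ?_⟩
    linarith [h.2.2.1 x hx, norm_nonneg (fderiv ℝ f x)]

/-- The class of order `0` of a map of class `m`. -/
theorem HolderClass.exists_zero (ε : ℝ) (hε₀ : 0 < ε) (hε₁ : ε ≤ 1) (m : ℕ) :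
    ∃ K : ℝ, 0 < K ∧ ∀ (C : ℝ) (E : Type u) [NormedAddCommGroup E] [NormedSpace ℝ E] (F : Type u)
      [NormedAddCommGroup F] [NormedSpace ℝ F] (S : Set E) (f : E → F), IsOpen S → Convex ℝ S →
      HolderClass ε C m f S → HolderClass ε (K * C) 0 f S := by
  induction m with
  | zero => exact ⟨1, one_pos, fun C E _ _ F _ _ S f _ _ h => by simpa using h⟩
  | succ m ih =>
    obtain ⟨K, hK, h⟩ := ih
    refine ⟨K * 2, by positivity, fun C E _ _ F _ _ S f hS hc hf => ?_⟩
    rw [mul_assoc]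
    exact h _ E F S f hS hc (hf.of_succ hε₀ hε₁ hS hc)

/-- Leibniz rule. Each of the two terms of the derivative pairs a derivative with an
undifferentiated factor, from which one order is forgotten at the cost of a factor 2. Two terms with
that factor each give the 4 gained at every order; the initial 2 comes from the Hölder estimate at
order 0. -/
theorem HolderClass.bilinear (hε₀ : 0 < ε) (hε₁ : ε ≤ 1) (hS : IsOpen S) (hconv : Convex ℝ S)
    {F G H : Type u} [NormedAddCommGroup F] [NormedSpace ℝ F] [NormedAddCommGroup G]
    [NormedSpace ℝ G] [NormedAddCommGroup H] [NormedSpace ℝ H] {f : E → F} {g : E → G}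
    (hf : HolderClass ε C m f S) (hg : HolderClass ε C' m g S) {K : ℝ} (B : F →L[ℝ] G →L[ℝ] H)
    (hB : ‖B‖ ≤ K) : HolderClass ε (2 * 4 ^ m * K * C * C') m (fun x => B (f x) (g x)) S := by
  have hK : 0 ≤ K := (ContinuousLinearMap.opNorm_nonneg B).trans hB
  have hle : ∀ x ∈ S, ∀ y ∈ S, ‖B (f x) (g y)‖ ≤ K * C * C' := fun x hx y hy =>
    (B (f x)).le_of_opNorm_le_of_le (B.le_of_opNorm_le_of_le hB (hf.norm_le x hx))
      (hg.norm_le y hy)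
  have hle' : ∀ x ∈ S, ‖B (f x) (g x)‖ ≤ 2 * 4 ^ m * K * C * C' := fun x hx => by
    have h1 : 0 ≤ C := (norm_nonneg _).trans (hf.norm_le x hx)
    have h2 : 0 ≤ C' := (norm_nonneg _).trans (hg.norm_le x hx)
    have h3 : (1 : ℝ) ≤ 2 * 4 ^ m := by
      have : (1 : ℝ) ≤ 4 ^ m := one_le_pow₀ (by norm_num)
      linarith
    have h4 : 0 ≤ K * C * C' := by positivity
    have := hle x hx x hx
    nlinarith
  induction m generalizing F G H C C' with
  | zero =>
    refine ⟨hle', fun x hx y hy => ?_⟩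
    have h1 : B (f x) (g x) - B (f y) (g y) = B (f x - f y) (g x) + B (f y) (g x - g y) := by
      simp
    have h2 : ‖B (f x - f y) (g x)‖ ≤ K * (C * ‖x - y‖ ^ ε) * C' :=
      (B (f x - f y)).le_of_opNorm_le_of_le (B.le_of_opNorm_le_of_le hB (hf.2 x hx y hy))
        (hg.norm_le x hx)
    have h3 : ‖B (f y) (g x - g y)‖ ≤ K * C * (C' * ‖x - y‖ ^ ε) :=
      (B (f y)).le_of_opNorm_le_of_le (B.le_of_opNorm_le_of_le hB (hf.norm_le y hy))
        (hg.2 x hx y hy)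
    rw [h1]
    refine (norm_add_le _ _).trans ((add_le_add h2 h3).trans (le_of_eq ?_))
    ring
  | succ m ih =>
    have hfd : ∀ x ∈ S, DifferentiableAt ℝ f x := fun x hx =>
      (hf.2.1 x hx).differentiableAt (hS.mem_nhds hx)
    have hgd : ∀ x ∈ S, DifferentiableAt ℝ g x := fun x hx =>
      (hg.2.1 x hx).differentiableAt (hS.mem_nhds hx)
    refine ⟨hle', fun x hx => ?_, ?_⟩
    · exact (B.hasFDerivAt_of_bilinear (hfd x hx).hasFDerivAt
        (hgd x hx).hasFDerivAt).differentiableAt.differentiableWithinAt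
    -- The induction hypothesis with its pointwise bounds discharged, for arbitrary spaces, since it
    -- is applied to both `precompR` and `precompL`.
    have key : ∀ {F G H : Type u} [NormedAddCommGroup F] [NormedSpace ℝ F] [NormedAddCommGroup G]
        [NormedSpace ℝ G] [NormedAddCommGroup H] [NormedSpace ℝ H] {f : E → F} {g : E → G}
        {C C' : ℝ} (_ : HolderClass ε C m f S) (_ : HolderClass ε C' m g S)
        (B : F →L[ℝ] G →L[ℝ] H) (_ : ‖B‖ ≤ K),
        HolderClass ε (2 * 4 ^ m * K * C * C') m (fun x => B (f x) (g x)) S := by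
      intro F G H _ _ _ _ _ _ f g C C' hf hg B hB
      refine ih hf hg B hB (fun x hx y hy => ?_) fun x hx => ?_
      · exact (B (f x)).le_of_opNorm_le_of_le (B.le_of_opNorm_le_of_le hB (hf.norm_le x hx))
          (hg.norm_le y hy)
      · have h1 : 0 ≤ C := (norm_nonneg _).trans (hf.norm_le x hx)
        have h2 : 0 ≤ C' := (norm_nonneg _).trans (hg.norm_le x hx)
        have h3 : (1 : ℝ) ≤ 2 * 4 ^ m := by
          have : (1 : ℝ) ≤ 4 ^ m := one_le_pow₀ (by norm_num)
          linarith
        have h4 : 0 ≤ K * C * C' := by positivity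
        have := (B (f x)).le_of_opNorm_le_of_le (B.le_of_opNorm_le_of_le hB (hf.norm_le x hx))
          (hg.norm_le x hx)
        nlinarith
    have h1 := key (hf.of_succ hε₀ hε₁ hS hconv) hg.2.2 (B.precompR E)
      ((B.norm_precompR_le E).trans hB)
    have h2 := key hf.2.2 (hg.of_succ hε₀ hε₁ hS hconv) (B.precompL E)
      ((B.norm_precompL_le E).trans hB)
    have h3 := (h1.add hS h2).congr hS fun x hx => B.fderiv_of_bilinear (hfd x hx) (hgd x hx)
    convert h3 using 1
    ring

theorem LipClass.of_succ (hε₀ : 0 < ε) (hε₁ : ε ≤ 1) (hC : 0 ≤ C) (hS : IsOpen S)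
    (hconv : Convex ℝ S) {F : Type u} [NormedAddCommGroup F] [NormedSpace ℝ F] {f : E → F}
    (h : LipClass ε C (m + 1) f S) : LipClass ε (2 * C) m f S := by
  refine ⟨fun x hx y hy => (h.1 x hx y hy).trans (by gcongr; linarith), fun l hl => ?_⟩
  subst hl
  obtain ⟨h1, h2⟩ := h.2 _ rfl
  exact ⟨h1, h2.of_succ hε₀ hε₁ hS hconv⟩

theorem LipClass.of_fderiv (hS : IsOpen S) (hconv : Convex ℝ S) {F : Type u}
    [NormedAddCommGroup F] [NormedSpace ℝ F] {f : E → F} (hf : DifferentiableOn ℝ f S)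
    (h : HolderClass ε C m (fderiv ℝ f) S) : LipClass ε C (m + 1) f S := by
  refine ⟨fun x hx y hy => ?_, fun l hl => ?_⟩
  · exact hconv.norm_image_sub_le_of_norm_fderiv_le
      (fun z hz => (hf z hz).differentiableAt (hS.mem_nhds hz)) (fun z hz => h.norm_le z hz) hy hx
  · obtain rfl : m = l := by omega
    exact ⟨hf, h⟩

theorem HolderClass.lipClass (hS : IsOpen S) (hconv : Convex ℝ S) {F : Type u}
    [NormedAddCommGroup F] [NormedSpace ℝ F] {f : E → F} (h : HolderClass ε C (m + 1) f S) :
    LipClass ε C (m + 1) f S :=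
  LipClass.of_fderiv hS hconv h.2.1 h.2.2

theorem LipClass.affine (hS : IsOpen S) (hconv : Convex ℝ S) (hC : 0 ≤ C) {F : Type u}
    [NormedAddCommGroup F] [NormedSpace ℝ F] (A : E →L[ℝ] F) (hA : ‖A‖ ≤ C) (c : F) :
    LipClass ε C (m + 1) (fun x => A x + c) S := by
  have h : ∀ x, HasFDerivAt (fun x => A x + c) A x := fun x => A.hasFDerivAt.add_const c
  refine LipClass.of_fderiv hS hconv (fun x _ => (h x).differentiableAt.differentiableWithinAt) ?_
  rw [show fderiv ℝ (fun x => A x + c) = fun _ => A from funext fun x => (h x).fderiv]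
  exact HolderClass.const hC A hA

/-- Chain rule, read as the bilinear map `compL`, of norm at most 1, applied to two maps of class
`m`. -/
theorem HolderClass.fderiv_comp (hε₀ : 0 < ε) (hε₁ : ε ≤ 1) (hS : IsOpen S) (hconv : Convex ℝ S)
    {F G : Type u} [NormedAddCommGroup F] [NormedSpace ℝ F] [NormedAddCommGroup G]
    [NormedSpace ℝ G] {T : Set F} (hT : IsOpen T) {f : E → F} {g : F → G}
    (hg : DifferentiableOn ℝ g T) (hf : DifferentiableOn ℝ f S) (hmaps : Set.MapsTo f S T)
    (h₁ : HolderClass ε C m (fun x => fderiv ℝ g (f x)) S)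
    (h₂ : HolderClass ε C' m (fderiv ℝ f) S) :
    HolderClass ε (2 * 4 ^ m * 1 * C * C') m (fderiv ℝ fun x => g (f x)) S := by
  refine (h₁.bilinear hε₀ hε₁ hS hconv h₂ (ContinuousLinearMap.compL ℝ E F G)
    (ContinuousLinearMap.norm_compL_le ℝ E F G)).congr hS fun x hx => ?_
  exact _root_.fderiv_comp x ((hg _ (hmaps hx)).differentiableAt (hT.mem_nhds (hmaps hx)))
    ((hf x hx).differentiableAt (hS.mem_nhds hx))

/-- The composition of maps of class `m` is of class `m`, with a constant which does not depend on
the spaces. -/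
theorem HolderClass.exists_comp (hε₀ : 0 < ε) (hε₁ : ε ≤ 1) (C₁ C₂ : ℝ) (hC₁ : 0 ≤ C₁)
    (hC₂ : 0 ≤ C₂) (m : ℕ) :
    ∃ C : ℝ, 0 ≤ C ∧ ∀ (E : Type u) [NormedAddCommGroup E] [NormedSpace ℝ E] (F : Type u)
      [NormedAddCommGroup F] [NormedSpace ℝ F] (G : Type u) [NormedAddCommGroup G]
      [NormedSpace ℝ G] (S : Set E) (T : Set F) (f : E → F) (g : F → G),
      IsOpen S → Convex ℝ S → IsOpen T → Set.MapsTo f S T →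
      HolderClass ε C₁ m g T → LipClass ε C₂ m f S →
      HolderClass ε C m (fun x => g (f x)) S := by
  induction m generalizing C₂ with
  | zero =>
    refine ⟨C₁ + C₁ * C₂ ^ ε, by positivity, fun E _ _ F _ _ G _ _ S T f g hS hc hT hm hg hf => ?_⟩
    refine ⟨fun x hx => ?_, fun x hx y hy => ?_⟩
    · have : 0 ≤ C₁ * C₂ ^ ε := by positivity
      linarith [hg.1 _ (hm hx)]
    · have h1 := hg.2 _ (hm hx) _ (hm hy)
      have h2 : ‖f x - f y‖ ^ ε ≤ (C₂ * ‖x - y‖) ^ ε :=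
        Real.rpow_le_rpow (norm_nonneg _) (hf.1 x hx y hy) hε₀.le
      rw [Real.mul_rpow hC₂ (norm_nonneg _)] at h2
      have h3 : 0 ≤ C₁ * ‖x - y‖ ^ ε := by positivity
      nlinarith [mul_le_mul_of_nonneg_left h2 hC₁]
  | succ m ih =>
    -- The chain rule needs `fderiv ℝ g ∘ f` at order `m` only, where the inner map has constant `2
    -- * C₂` after forgetting a derivative.
    obtain ⟨C, hC, h⟩ := ih (2 * C₂) (by positivity)
    refine ⟨C₁ + 2 * 4 ^ m * 1 * C * C₂, by positivity,
      fun E _ _ F _ _ G _ _ S T f g hS hc hT hm hg hf => ?_⟩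
    obtain ⟨hfd, hfh⟩ := hf.2 m rfl
    refine ⟨fun x hx => ?_, hg.2.1.comp hfd hm, ?_⟩
    · have : 0 ≤ 2 * 4 ^ m * 1 * C * C₂ := by positivity
      linarith [hg.1 _ (hm hx)]
    · have h1 := h E F (F →L[ℝ] G) S T f (fderiv ℝ g) hS hc hT hm hg.2.2
        (hf.of_succ hε₀ hε₁ hC₂ hS hc)
      refine (h1.fderiv_comp hε₀ hε₁ hS hc hT hg.2.1 hfd hm hfh).mono_const ?_
      linarith

/-- Pointwise inversion preserves the class, with a constant which does not depend on the
spaces. -/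
theorem HolderClass.exists_ringInverse (hε₀ : 0 < ε) (hε₁ : ε ≤ 1) (C₁ C₂ : ℝ) (hC₁ : 0 ≤ C₁)
    (hC₂ : 0 ≤ C₂) (m : ℕ) :
    ∃ C : ℝ, 0 ≤ C ∧ ∀ (E : Type u) [NormedAddCommGroup E] [NormedSpace ℝ E] (R : Type u)
      [NormedRing R] [NormedAlgebra ℝ R] [CompleteSpace R] (S : Set E) (A : E → R),
      IsOpen S → Convex ℝ S → HolderClass ε C₁ m A S → (∀ x ∈ S, IsUnit (A x)) →
      (∀ x ∈ S, ‖Ring.inverse (A x)‖ ≤ C₂) → HolderClass ε C m (fun x => Ring.inverse (A x)) S := by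
  induction m generalizing C₁ with
  | zero =>
    refine ⟨C₂ + C₂ * C₁ * C₂, by positivity, fun E _ _ R _ _ _ S A hS hc hA hu hb => ?_⟩
    refine ⟨fun x hx => ?_, fun x hx y hy => ?_⟩
    · have : 0 ≤ C₂ * C₁ * C₂ := by positivity
      linarith [hb x hx]
    · obtain ⟨u, hu'⟩ := hu x hx
      obtain ⟨v, hv'⟩ := hu y hy
      -- Resolvent identity.
      have h1 : Ring.inverse (A x) - Ring.inverse (A y)
          = Ring.inverse (A x) * (A y - A x) * Ring.inverse (A y) := by
        rw [← hu', ← hv']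
        simp [mul_sub, sub_mul]
      rw [h1]
      have h2 : ‖A y - A x‖ ≤ C₁ * ‖x - y‖ ^ ε := by
        rw [norm_sub_rev x y]
        exact hA.2 y hy x hx
      calc _ ≤ ‖Ring.inverse (A x)‖ * ‖A y - A x‖ * ‖Ring.inverse (A y)‖ :=
            (norm_mul_le _ _).trans (by gcongr; exact norm_mul_le _ _)
        _ ≤ C₂ * (C₁ * ‖x - y‖ ^ ε) * C₂ := by
            gcongr
            · exact hb x hx
            · exact hb y hy
        _ ≤ _ := by
            have : 0 ≤ C₂ * ‖x - y‖ ^ ε := by positivity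
            nlinarith
  | succ m ih =>
    obtain ⟨C, hC, h⟩ := ih (2 * C₁) (by positivity)
    refine ⟨C₂ + 2 * 4 ^ m * 1 * (2 * 4 ^ m * 1 * C * C) * C₁, by positivity,
      fun E _ _ R _ _ _ S A hS hc hA hu hb => ?_⟩
    -- The derivative `-A⁻¹ A' A⁻¹` involves only `A⁻¹` and `A'` at order `m`, so the induction
    -- closes through two bilinear products.
    have hd : ∀ x ∈ S, HasFDerivAt (fun x => Ring.inverse (A x))
        ((-ContinuousLinearMap.mulLeftRight ℝ R (Ring.inverse (A x)) (Ring.inverse (A x))).comp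
          (fderiv ℝ A x)) x := by
      intro x hx
      obtain ⟨u, hu'⟩ := hu x hx
      have h1 := hasFDerivAt_ringInverse (𝕜 := ℝ) u
      rw [hu'] at h1
      have h2 := h1.comp x ((hA.2.1 x hx).differentiableAt (hS.mem_nhds hx)).hasFDerivAt
      rw [← hu']
      simpa [Function.comp_def] using h2
    refine ⟨fun x hx => ?_, fun x hx => (hd x hx).differentiableAt.differentiableWithinAt, ?_⟩
    · have : 0 ≤ 2 * 4 ^ m * 1 * (2 * 4 ^ m * 1 * C * C) * C₁ := by positivity
      linarith [hb x hx]
    · have h1 := h E R S A hS hc (hA.of_succ hε₀ hε₁ hS hc) hu hb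
      have h2 := h1.bilinear hε₀ hε₁ hS hc h1 (ContinuousLinearMap.mulLeftRight ℝ R)
        (ContinuousLinearMap.opNorm_mulLeftRight_le ℝ R)
      have h3 := h2.bilinear hε₀ hε₁ hS hc hA.2.2 (ContinuousLinearMap.compL ℝ E R R)
        (ContinuousLinearMap.norm_compL_le ℝ E R R)
      refine ((h3.neg hS).congr hS fun x hx => ?_).mono_const (by linarith)
      rw [(hd x hx).fderiv]
      ext v
      simp

/-- A uniform local estimate is a global one. -/
theorem HolderClass.of_local (hε₀ : 0 < ε) {ρ : ℝ} (hρ : 0 < ρ) (hC : 0 ≤ C) {F : Type u}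
    [NormedAddCommGroup F] [NormedSpace ℝ F] {f : E → F}
    (h : ∀ x ∈ S, HolderClass ε C m f (Metric.ball x ρ)) :
    HolderClass ε (C + 2 * C / ρ ^ ε) m f S := by
  have h0 : 0 ≤ 2 * C / ρ ^ ε := by positivity
  have h1 : ∀ x ∈ S, ‖f x‖ ≤ C + 2 * C / ρ ^ ε := fun x hx => by
    linarith [(h x hx).norm_le x (Metric.mem_ball_self hρ)]
  induction m generalizing F with
  | zero =>
    refine ⟨h1, fun x hx y hy => ?_⟩
    have hd : 0 ≤ ‖x - y‖ ^ ε := by positivity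
    rcases lt_or_ge ‖x - y‖ ρ with hlt | hge
    · refine ((h y hy).2 x (by simpa [dist_eq_norm] using hlt) y
        (Metric.mem_ball_self hρ)).trans ?_
      gcongr
      linarith
    -- Points at distance at least `ρ` need only the sup bound; this is the source of the term `2 *
    -- C / ρ ^ ε`.
    · have h2 : ρ ^ ε ≤ ‖x - y‖ ^ ε := Real.rpow_le_rpow hρ.le hge hε₀.le
      have h3 : 2 * C ≤ 2 * C / ρ ^ ε * ‖x - y‖ ^ ε := by
        rw [div_mul_eq_mul_div, le_div_iff₀ (by positivity)]
        gcongr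
      have h4 := (h x hx).norm_le x (Metric.mem_ball_self hρ)
      have h5 := (h y hy).norm_le y (Metric.mem_ball_self hρ)
      have h6 := norm_sub_le (f x) (f y)
      nlinarith [mul_nonneg hC hd]
  | succ m ih =>
    refine ⟨h1, fun x hx => ?_, ih (fun x hx => (h x hx).2.2) fun x hx => ?_⟩
    · exact (((h x hx).2.1 x (Metric.mem_ball_self hρ)).differentiableAt
        (Metric.ball_mem_nhds x hρ)).differentiableWithinAt
    · linarith [(h x hx).2.2.norm_le x (Metric.mem_ball_self hρ)]

end Calculus

/-! ### Symmetry of higher derivatives on open sets. -/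

section Symmetry

variable {E : Type u} [NormedAddCommGroup E] [NormedSpace ℝ E] {S : Set E}

/-- The derivative of order `m` of a map of class `C^m` is symmetric. -/
theorem ContDiffOn.iteratedFDeriv_comp_perm (hS : IsOpen S) {F : Type u} [NormedAddCommGroup F]
    [NormedSpace ℝ F] {f : E → F} {m : ℕ} (hf : ContDiffOn ℝ (m : WithTop ℕ∞) f S) {x : E}
    (hx : x ∈ S) (σ : Equiv.Perm (Fin m)) (v : Fin m → E) :
    iteratedFDeriv ℝ m f x (fun i => v (σ i)) = iteratedFDeriv ℝ m f x v := by
  induction m generalizing F f x with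
  | zero => exact congrArg _ (Subsingleton.elim _ _)
  | succ m ih =>
    rcases m with - | m
    · obtain rfl : σ = 1 := Equiv.ext fun i => Fin.ext (by omega)
      rfl
    -- Adjacent transpositions generate, so it suffices to treat them one at a time.
    have hmem : σ ∈ Submonoid.closure
        (Set.range fun i : Fin (m + 1) => Equiv.swap i.castSucc i.succ) := by
      rw [Equiv.Perm.mclosure_swap_castSucc_succ]
      trivial
    induction hmem using Submonoid.closure_induction generalizing v with
    | one => rfl
    | mul a b _ _ ha hb => exact (hb fun i => v (a i)).trans (ha v)
    | mem a ha =>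
      obtain ⟨i, rfl⟩ := ha
      rcases Fin.eq_zero_or_eq_succ i with rfl | ⟨j, rfl⟩
      · rcases m with - | m
        · have h2 : ContDiffAt ℝ 2 f x := hf.contDiffAt (hS.mem_nhds hx)
          have h3 := h2.isSymmSndFDerivAt (by simp)
          have e := h3.eq (v 1) (v 0)
          simpa [iteratedFDeriv_two_apply] using e
        -- The swap of the first two slots leaves the last slot alone: peel that slot off and use
        -- the induction hypothesis for `fderiv ℝ f`. Order 2 is Schwarz's theorem.
        · refine (iteratedFDeriv_succ_apply_right _).trans
            (Eq.trans ?_ (iteratedFDeriv_succ_apply_right v).symm)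
          have h1 := (((contDiffOn_succ_iff_fderiv_of_isOpen (n := ((m + 1 + 1 : ℕ) : WithTop ℕ∞))
            hS).1 (by exact_mod_cast hf)).2.2)
          have h2 := ih h1 hx (Equiv.swap 0 1) (Fin.init v)
          have h3 : (Equiv.swap (0 : Fin (m + 1 + 1)).castSucc (0 : Fin (m + 1 + 1)).succ)
              (Fin.last (m + 1 + 1)) = Fin.last (m + 1 + 1) :=
            Equiv.swap_apply_of_ne_of_ne (by simp [Fin.ext_iff]) (by simp [Fin.ext_iff])
          simp only [h3]
          rw [← h2]
          congr 2
          ext1 l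
          simp only [Fin.init]
          congr 1
          rw [← (Fin.castSucc_injective _).swap_apply]
          rfl
      -- Any other adjacent swap fixes slot 0: differentiate the symmetry of the derivative one
      -- order lower.
      · rw [iteratedFDeriv_succ_apply_left, iteratedFDeriv_succ_apply_left]
        have h1 : ∀ y ∈ S, ∀ w : Fin (m + 1) → E,
            iteratedFDeriv ℝ (m + 1) f y (fun l => w (Equiv.swap j.castSucc j.succ l)) =
              iteratedFDeriv ℝ (m + 1) f y w := fun y hy w =>
          ih (hf.of_le (by exact_mod_cast Nat.le_succ _)) hy _ w
        have h2 : DifferentiableAt ℝ (iteratedFDeriv ℝ (m + 1) f) x :=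
          (hf.contDiffAt (hS.mem_nhds hx)).differentiableAt_iteratedFDeriv
            (by exact_mod_cast Nat.lt_succ_self _)
        have h3 : ∀ w : Fin (m + 1) → E, ∀ a : E, fderiv ℝ (iteratedFDeriv ℝ (m + 1) f) x a w
            = fderiv ℝ (fun y => iteratedFDeriv ℝ (m + 1) f y w) x a := fun w a => by
          have := ((ContinuousMultilinearMap.apply ℝ (fun _ : Fin (m + 1) => E) F w).hasFDerivAt
            (x := iteratedFDeriv ℝ (m + 1) f x)).comp x h2.hasFDerivAt
          exact (congrArg (fun A => A a) this.fderiv).symm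
        have h0 : (Equiv.swap (j.succ).castSucc (j.succ).succ) (0 : Fin (m + 1 + 1)) = 0 :=
          Equiv.swap_apply_of_ne_of_ne (by simp [Fin.ext_iff]) (by simp [Fin.ext_iff])
        have ht : Fin.tail (fun l => v ((Equiv.swap (j.succ).castSucc (j.succ).succ) l))
            = fun l => Fin.tail v (Equiv.swap j.castSucc j.succ l) := by
          ext1 l
          simp only [Fin.tail]
          congr 1
          rw [← (Fin.succ_injective _).swap_apply]
          rfl
        rw [ht, h0, h3, h3]
        congr 1
        exact Filter.EventuallyEq.fderiv_eq
          (Filter.eventuallyEq_of_mem (hS.mem_nhds hx) fun y hy => h1 y hy _)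

/-- By symmetry the slot of `fderiv` can be taken first instead of last, which is the convention
matching `padTuple` and `Fin.cons`. -/
theorem iteratedFDeriv_succ_apply_tail (hS : IsOpen S) {F : Type u} [NormedAddCommGroup F]
    [NormedSpace ℝ F] {f : E → F} {m : ℕ} (hf : ContDiffOn ℝ ((m + 1 : ℕ) : WithTop ℕ∞) f S) {x : E}
    (hx : x ∈ S) (v : Fin (m + 1) → E) :
    iteratedFDeriv ℝ (m + 1) f x v
      = iteratedFDeriv ℝ m (fderiv ℝ f) x (Fin.tail v) (v 0) := by
  rw [← hf.iteratedFDeriv_comp_perm hS hx (finRotate _) v, iteratedFDeriv_succ_apply_right]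
  simp only [finRotate_last]
  congr 2
  ext1 l
  simp [Fin.init, Fin.tail]

end Symmetry

/-! ### Taylor expansion: from Hölder classes to Lipschitz jets. -/

section Taylor

variable {E : Type u} [NormedAddCommGroup E] [NormedSpace ℝ E] {S : Set E} {ε C : ℝ} {m : ℕ}

theorem HolderClass.norm_iteratedFDeriv_le {F : Type u} [NormedAddCommGroup F] [NormedSpace ℝ F]
    {f : E → F} (h : HolderClass ε C m f S) {k : ℕ} (hk : k ≤ m) {x : E} (hx : x ∈ S) :
    ‖iteratedFDeriv ℝ k f x‖ ≤ C := by
  induction k generalizing m F with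
  | zero => simpa using h.norm_le x hx
  | succ k ih =>
    obtain ⟨m, rfl⟩ : ∃ l, m = l + 1 := ⟨m - 1, by omega⟩
    rw [← norm_iteratedFDeriv_fderiv]
    exact ih h.2.2 (by omega)

/-- Along the segment from `y` to `x`, the derivative of the remainder of `f` is the remainder of
`fderiv ℝ f`, one order lower, evaluated on `x - y`. The mean value inequality on `[0, 1]` then
preserves the constant. -/
theorem HolderClass.norm_sub_taylor_le (hε : 0 < ε) (hconv : Convex ℝ S) (hS : IsOpen S)
    {F : Type u} [NormedAddCommGroup F] [NormedSpace ℝ F] {f : E → F} (h : HolderClass ε C m f S)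
    {x y : E} (hx : x ∈ S) (hy : y ∈ S) :
    ‖f x - ∑ j ∈ Finset.range (m + 1),
      (j.factorial : ℝ)⁻¹ • iteratedFDeriv ℝ j f y (fun _ => x - y)‖
      ≤ C * ‖x - y‖ ^ ((m : ℝ) + ε) := by
  induction m generalizing F x with
  | zero => simpa using h.2 x hx y hy
  | succ m ih =>
    have hC : 0 ≤ C := (norm_nonneg _).trans (h.1 x hx)
    set w := x - y with hw
    set c : ℕ → F := fun j => iteratedFDeriv ℝ j f y (fun _ => w) with hc
    have hmem : ∀ t ∈ Set.Icc (0 : ℝ) 1, y + t • w ∈ S := fun t ht =>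
      hconv.add_smul_sub_mem hy hx ht
    have hder : ∀ t ∈ Set.Icc (0 : ℝ) 1, HasDerivAt
        (fun t : ℝ => f (y + t • w) - ∑ j ∈ Finset.range (m + 1 + 1),
          (t ^ j * (j.factorial : ℝ)⁻¹) • c j)
        (fderiv ℝ f (y + t • w) w - ∑ j ∈ Finset.range (m + 1),
          (t ^ j * (j.factorial : ℝ)⁻¹) • c (j + 1)) t := by
      intro t ht
      have h1 : HasDerivAt (fun t : ℝ => y + t • w) w t := by
        simpa using ((hasDerivAt_id t).smul_const w).const_add y
      have h2 := ((h.2.1 _ (hmem t ht)).differentiableAt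
        (hS.mem_nhds (hmem t ht))).hasFDerivAt.comp_hasDerivAt t h1
      refine h2.sub ?_
      simp only [Finset.sum_range_succ' _ (m + 1), pow_zero]
      refine HasDerivAt.add_const _ (HasDerivAt.fun_sum fun j _ => ?_)
      refine HasDerivAt.smul_const ?_ _
      have h3 := (hasDerivAt_pow (j + 1) t).mul_const (((j + 1).factorial : ℝ)⁻¹)
      convert h3 using 1
      have h4 : ((j.factorial : ℕ) : ℝ) ≠ 0 := by exact_mod_cast j.factorial_ne_zero
      rw [Nat.factorial_succ, Nat.add_sub_cancel]
      push_cast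
      field_simp
    have hbound : ∀ t ∈ Set.Ico (0 : ℝ) 1,
        ‖fderiv ℝ f (y + t • w) w - ∑ j ∈ Finset.range (m + 1),
          (t ^ j * (j.factorial : ℝ)⁻¹) • c (j + 1)‖ ≤ C * ‖w‖ ^ (((m + 1 : ℕ) : ℝ) + ε) := by
      intro t ht
      have h1 := ih h.2.2 (hmem t ⟨ht.1, ht.2.le⟩)
      have h2 : fderiv ℝ f (y + t • w) w - ∑ j ∈ Finset.range (m + 1),
          (t ^ j * (j.factorial : ℝ)⁻¹) • c (j + 1) =
          (fderiv ℝ f (y + t • w) - ∑ j ∈ Finset.range (m + 1),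
            (j.factorial : ℝ)⁻¹ • iteratedFDeriv ℝ j (fderiv ℝ f) y
              (fun _ => y + t • w - y)) w := by
        simp only [_root_.sub_apply, _root_.sum_apply,
          _root_.smul_apply, add_sub_cancel_left]
        congr 1
        refine Finset.sum_congr rfl fun j _ => ?_
        have h3 := (iteratedFDeriv ℝ j (fderiv ℝ f) y).map_smul_univ (fun _ => t) (fun _ => w)
        simp only [Finset.prod_const, Finset.card_univ, Fintype.card_fin] at h3
        rw [h3, hc]
        simp only [iteratedFDeriv_succ_apply_right, _root_.smul_apply, smul_smul]
        rw [mul_comm]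
        rfl
      rw [h2]
      have h4 : ‖y + t • w - y‖ ≤ ‖w‖ := by
        rw [add_sub_cancel_left, norm_smul, Real.norm_of_nonneg ht.1]
        exact mul_le_of_le_one_left (norm_nonneg _) ht.2.le
      have h5 : ‖w‖ ^ (((m + 1 : ℕ) : ℝ) + ε) = ‖w‖ ^ ((m : ℝ) + ε) * ‖w‖ := by
        have : (((m + 1 : ℕ) : ℝ) + ε) = (m : ℝ) + ε + 1 := by push_cast; ring
        rw [this, Real.rpow_add_one' (norm_nonneg _) (by positivity)]
      rw [h5, ← mul_assoc]
      refine ContinuousLinearMap.le_of_opNorm_le _ (h1.trans ?_) w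
      gcongr
    have h6 := norm_image_sub_le_of_norm_deriv_le_segment_01'
      (fun t ht => (hder t ht).hasDerivWithinAt) hbound
    have h7 : ∑ j ∈ Finset.range (m + 1 + 1), ((0 : ℝ) ^ j * (j.factorial : ℝ)⁻¹) • c j = f y := by
      rw [Finset.sum_range_succ']
      simp [hc]
    simp only [one_smul, zero_smul, add_zero, one_pow, one_mul, h7, sub_self, sub_zero] at h6
    simpa [hw] using h6

theorem padTuple_zero {E : Type*} {j : ℕ} (v : Fin 0 → E) (h : E) :
    padTuple j v h = fun _ => h := by
  ext1 i
  simp [padTuple]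

theorem padTuple_succ {E : Type*} {k j : ℕ} (v : Fin (k + 1) → E) (h : E) :
    padTuple (j + 1) v h = Fin.cons (v 0) (padTuple j (Fin.tail v) h) := by
  ext1 i
  refine Fin.cases ?_ (fun i => ?_) i
  · simp [padTuple]
  · simp [padTuple, Fin.tail]

theorem sum_Icc_succ_succ {F : Type*} [AddCommMonoid F] (k m : ℕ) (g : ℕ → F) :
    ∑ j ∈ Finset.Icc (k + 1) (m + 1), g j = ∑ j ∈ Finset.Icc k m, g (j + 1) := by
  rw [← Finset.map_add_right_Icc, Finset.sum_map]
  rfl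

/-- The expansion of the derivative of order `k + 1` is that of order `k` for `fderiv ℝ f`, with the
extra variable put in the first slot; the exponent `m + ε - k` is unchanged by this shift. -/
theorem HolderClass.exists_remainder (hε : 0 < ε) (hconv : Convex ℝ S) (hS : IsOpen S)
    {F : Type u} [NormedAddCommGroup F] [NormedSpace ℝ F] {f : E → F} (h : HolderClass ε C m f S)
    {k : ℕ} (hk : k ≤ m) {x y : E} (hx : x ∈ S) (hy : y ∈ S) :
    ∃ r : ContinuousMultilinearMap ℝ (fun _ : Fin k => E) F,
      (∀ v : Fin k → E, iteratedFDeriv ℝ k f x v =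
        (∑ j ∈ Finset.Icc k m, ((j - k).factorial : ℝ)⁻¹ •
          iteratedFDeriv ℝ j f y (padTuple j v (x - y))) + r v) ∧
      ‖r‖ ≤ C * ‖x - y‖ ^ ((m : ℝ) + ε - (k : ℝ)) := by
  induction k generalizing m F with
  | zero =>
    refine ⟨ContinuousMultilinearMap.uncurry0 ℝ E (f x - ∑ j ∈ Finset.range (m + 1),
      (j.factorial : ℝ)⁻¹ • iteratedFDeriv ℝ j f y (fun _ => x - y)), fun v => ?_, ?_⟩
    · rw [← Nat.range_succ_eq_Icc_zero]
      simp [padTuple_zero]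
    · rw [ContinuousMultilinearMap.uncurry0_norm]
      simpa using h.norm_sub_taylor_le hε hconv hS hx hy
  | succ k ih =>
    obtain ⟨m, rfl⟩ : ∃ l, m = l + 1 := ⟨m - 1, by omega⟩
    have hcd := h.contDiffOn hε hS
    obtain ⟨r, hr, hr'⟩ := ih h.2.2 (by omega)
    refine ⟨r.flipLinear.uncurryLeft, fun v => ?_, ?_⟩
    · rw [iteratedFDeriv_succ_apply_tail hS (hcd.of_le (by exact_mod_cast hk)) hx, hr,
        sum_Icc_succ_succ]
      simp only [_root_.add_apply, _root_.sum_apply,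
        _root_.smul_apply, Nat.add_sub_add_right]
      congr 1
      refine Finset.sum_congr rfl fun j hj => ?_
      rw [Finset.mem_Icc] at hj
      rw [iteratedFDeriv_succ_apply_tail hS
        (hcd.of_le (by exact_mod_cast Nat.succ_le_succ hj.2)) hy, padTuple_succ]
      simp
    · rw [ContinuousLinearMap.uncurryLeft_norm]
      have h1 : ‖r.flipLinear‖ ≤ ‖r‖ :=
        MultilinearMap.mkContinuousLinear_norm_le _ (norm_nonneg _) _
      refine (h1.trans hr').trans (le_of_eq ?_)
      push_cast
      ring_nf

/-- On an open convex set, maps of Hölder class `m` are `Lip-(m + ε)`. -/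
theorem HolderClass.isLipWith (hε : 0 < ε) (hconv : Convex ℝ S) (hS : IsOpen S)
    {F : Type u} [NormedAddCommGroup F] [NormedSpace ℝ F] {f : E → F}
    (h : HolderClass ε C m f S) : IsLipWith m ε C f S := by
  have hcd := h.contDiffOn hε hS
  refine ⟨ftaylorSeries ℝ f, fun x _ => rfl, ⟨fun k hk x hx σ v => ?_, fun k hk x hx => ?_, ?_⟩⟩
  · exact (hcd.of_le (by exact_mod_cast hk)).iteratedFDeriv_comp_perm hS hx σ v
  · exact h.norm_iteratedFDeriv_le hk hx
  -- The remainder is totalized by 0 outside the relevant range, so that it can be chosen for all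
  -- points and orders.
  · have key : ∀ x y : E, ∀ k : ℕ, ∃ r : ContinuousMultilinearMap ℝ (fun _ : Fin k => E) F,
        k ≤ m → x ∈ S → y ∈ S → (∀ v : Fin k → E, iteratedFDeriv ℝ k f x v =
        (∑ j ∈ Finset.Icc k m, ((j - k).factorial : ℝ)⁻¹ •
          iteratedFDeriv ℝ j f y (padTuple j v (x - y))) + r v) ∧
        ‖r‖ ≤ C * ‖x - y‖ ^ ((m : ℝ) + ε - (k : ℝ)) := by
      intro x y k
      by_cases hh : k ≤ m ∧ x ∈ S ∧ y ∈ S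
      · obtain ⟨r, hr⟩ := h.exists_remainder hε hconv hS hh.1 hh.2.1 hh.2.2
        exact ⟨r, fun _ _ _ => hr⟩
      · exact ⟨0, fun h1 h2 h3 => absurd ⟨h1, h2, h3⟩ hh⟩
    choose R hR using key
    exact ⟨fun x y k => R x y k, fun k hk x hx y hy => hR x y k hk hx hy⟩

end Taylor

/-! ### From Lipschitz jets on open sets back to Hölder classes. -/

section Jets

variable {E : Type u} [NormedAddCommGroup E] [NormedSpace ℝ E] {S S' : Set E} {ε M M' : ℝ} {m : ℕ}

theorem IsLipWith.mono_set {F : Type u} [NormedAddCommGroup F] [NormedSpace ℝ F] {f : E → F}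
    (hS : S' ⊆ S) (h : IsLipWith m ε M f S) : IsLipWith m ε M f S' := by
  obtain ⟨J, hJ, h1, h2, R, hR⟩ := h
  exact ⟨J, fun x hx => hJ x (hS hx), fun k hk x hx => h1 k hk x (hS hx),
    fun k hk x hx => h2 k hk x (hS hx), R,
    fun k hk x hx y hy => hR k hk x (hS hx) y (hS hy)⟩

theorem IsLipWith.mono_const {F : Type u} [NormedAddCommGroup F] [NormedSpace ℝ F] {f : E → F}
    (hM : M ≤ M') (h : IsLipWith m ε M f S) : IsLipWith m ε M' f S := by
  obtain ⟨J, hJ, h1, h2, R, hR⟩ := h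
  exact ⟨J, hJ, h1, fun k hk x hx => (h2 k hk x hx).trans hM, R,
    fun k hk x hx y hy => ⟨(hR k hk x hx y hy).1, (hR k hk x hx y hy).2.trans (by gcongr)⟩⟩

theorem IsLipWith.norm_le {F : Type u} [NormedAddCommGroup F] [NormedSpace ℝ F] {f : E → F}
    (h : IsLipWith m ε M f S) {x : E} (hx : x ∈ S) : ‖f x‖ ≤ M := by
  obtain ⟨J, hJ, h1, h2, R, hR⟩ := h
  rw [← hJ x hx, (J x 0).curry0_norm]
  exact h2 0 (Nat.zero_le _) x hx

/-- The collection of the derivatives of a Lipschitz collection. -/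
noncomputable def derivJet {F : Type u} [NormedAddCommGroup F] [NormedSpace ℝ F]
    (J : FormalMultilinearSeries ℝ E F) : FormalMultilinearSeries ℝ E (E →L[ℝ] F) :=
  fun k => (J (k + 1)).curryLeft.flipMultilinear

theorem derivJet_apply {F : Type u} [NormedAddCommGroup F] [NormedSpace ℝ F]
    (J : FormalMultilinearSeries ℝ E F) (k : ℕ) (v : Fin k → E) (w : E) :
    derivJet J k v w = J (k + 1) (Fin.cons w v) := rfl

theorem norm_derivJet_le {F : Type u} [NormedAddCommGroup F] [NormedSpace ℝ F]
    (J : FormalMultilinearSeries ℝ E F) (k : ℕ) : ‖derivJet J k‖ ≤ ‖J (k + 1)‖ := by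
  refine ContinuousMultilinearMap.opNorm_le_bound (norm_nonneg _) fun v =>
    ContinuousLinearMap.opNorm_le_bound _ (by positivity) fun w => ?_
  rw [derivJet_apply]
  refine ((J (k + 1)).le_opNorm _).trans (le_of_eq ?_)
  rw [Fin.prod_univ_succ]
  simp only [Fin.cons_zero, Fin.cons_succ]
  ring

theorem IsLipJet.deriv {F : Type u} [NormedAddCommGroup F] [NormedSpace ℝ F]
    {J : E → FormalMultilinearSeries ℝ E F} (h : IsLipJet (m + 1) ε M J S) :
    IsLipJet m ε M (fun x => derivJet (J x)) S := by
  obtain ⟨h1, h2, R, hR⟩ := h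
  refine ⟨fun k hk x hx σ v => ?_, fun k hk x hx => ?_, fun x y => derivJet (R x y),
    fun k hk x hx y hy => ⟨fun v => ?_, ?_⟩⟩
  · ext w
    rw [derivJet_apply, derivJet_apply]
    -- `σ` is extended to `k + 1` slots by fixing the first, which holds `w`.
    have := h1 (k + 1) (by omega) x hx (Equiv.Perm.decomposeFin.symm (0, σ)) (Fin.cons w v)
    rw [← this]
    congr 1
    ext1 i
    refine Fin.cases ?_ (fun i => ?_) i <;> simp
  · exact (norm_derivJet_le _ _).trans (h2 _ (by omega) x hx)
  · ext w
    have h3 := (hR (k + 1) (by omega) x hx y hy).1 (Fin.cons w v)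
    rw [derivJet_apply, h3, sum_Icc_succ_succ]
    simp only [_root_.add_apply, _root_.sum_apply,
      _root_.smul_apply, derivJet_apply, padTuple_succ, Fin.tail_cons, Fin.cons_zero,
      Nat.add_sub_add_right]
  · refine (norm_derivJet_le _ _).trans (((hR (k + 1) (by omega) x hx y hy).2).trans
      (le_of_eq ?_))
    push_cast
    ring_nf

/-- In the expansion at order 0, every term beyond the linear one is at least quadratic, and the
remainder is `O(‖w‖ ^ (m + 1 + ε))`; both are `o(w)`. -/
theorem IsLipJet.hasFDerivAt (hε : 0 < ε) (hS : IsOpen S) {F : Type u} [NormedAddCommGroup F]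
    [NormedSpace ℝ F] {J : E → FormalMultilinearSeries ℝ E F} {f : E → F}
    (hf : ∀ x ∈ S, (J x 0).curry0 = f x) (h : IsLipJet (m + 1) ε M J S) {x : E} (hx : x ∈ S) :
    HasFDerivAt f (derivJet (J x) 0).curry0 x := by
  obtain ⟨-, -, R, hR⟩ := h
  have h2 : ∀ᶠ w in nhds (0 : E), x + w ∈ S :=
    ((continuous_const.add continuous_id).tendsto' 0 x (add_zero x)).eventually (hS.mem_nhds hx)
  rw [hasFDerivAt_iff_isLittleO_nhds_zero]
  have h1 : (fun w => f (x + w) - f x - (derivJet (J x) 0).curry0 w) =ᶠ[nhds 0]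
      fun w => ∑ j ∈ Finset.range m, (((j + 1 + 1).factorial : ℝ)⁻¹ • J x (j + 1 + 1) fun _ => w)
        + R (x + w) x 0 0 := by
    filter_upwards [h2] with w hw
    have h3 := (hR 0 (Nat.zero_le _) (x + w) hw x hx).1 0
    rw [← Nat.range_succ_eq_Icc_zero, Finset.sum_range_succ', Finset.sum_range_succ'] at h3
    simp only [padTuple_zero, add_sub_cancel_left] at h3
    have h4 : f (x + w) = J (x + w) 0 0 := (hf _ hw).symm
    have h5 : (derivJet (J x) 0).curry0 w = J x 1 fun _ => w := by
      refine congrArg (J x 1) (funext fun i => ?_)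
      obtain rfl : i = 0 := Fin.ext (by omega)
      rfl
    have h6 : f x = J x 0 fun _ => w := (hf _ hx).symm.trans
      (congrArg (J x 0) (Subsingleton.elim _ _))
    rw [h4, h3, h5, h6]
    simp only [zero_add, Nat.sub_zero, Nat.factorial_one, Nat.factorial_zero, Nat.cast_one,
      inv_one, one_smul]
    abel
  refine Asymptotics.IsLittleO.congr' ?_ h1.symm Filter.EventuallyEq.rfl
  refine Asymptotics.IsLittleO.add (Asymptotics.IsLittleO.fun_sum fun j _ => ?_) ?_
  · refine Asymptotics.IsLittleO.const_smul_left ?_ _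
    refine Asymptotics.IsBigO.trans_isLittleO (Asymptotics.IsBigO.of_bound ‖J x (j + 1 + 1)‖
      (Filter.Eventually.of_forall fun w => ?_))
      (Asymptotics.isLittleO_norm_pow_id (E' := E) (n := j + 1 + 1) (by omega))
    simpa using (J x (j + 1 + 1)).le_opNorm fun _ => w
  · have h7 : Filter.Tendsto (fun w : E => ‖w‖ ^ ((m : ℝ) + ε)) (nhds 0) (nhds 0) := by
      have : Continuous fun w : E => ‖w‖ ^ ((m : ℝ) + ε) :=
        continuous_norm.rpow_const fun _ => Or.inr (by positivity)
      simpa [Real.zero_rpow (by positivity : (m : ℝ) + ε ≠ 0)] using this.tendsto 0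
    have h8 := ((Asymptotics.isLittleO_one_iff ℝ).2 h7).mul_isBigO
      (Asymptotics.isBigO_refl (fun w : E => ‖w‖) (nhds 0))
    simp only [one_mul] at h8
    refine Asymptotics.IsBigO.trans_isLittleO (Asymptotics.IsBigO.of_bound M ?_) h8.of_norm_right
    filter_upwards [h2] with w hw
    have h9 := (hR 0 (Nat.zero_le _) (x + w) hw x hx).2
    have h10 := (R (x + w) x 0).le_opNorm 0
    simp only [Finset.univ_eq_empty, Finset.prod_empty, mul_one] at h10
    refine (h10.trans h9).trans (le_of_eq ?_)
    rw [Real.norm_of_nonneg (by positivity), ← Real.rpow_add_one' (norm_nonneg _) (by positivity),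
      add_sub_cancel_left]
    congr 2
    push_cast
    ring

/-- On an open set, a Lipschitz collection consists of the derivatives of its zeroth term. -/
theorem IsLipJet.holderClass (hε : 0 < ε) (hS : IsOpen S) {F : Type u} [NormedAddCommGroup F]
    [NormedSpace ℝ F] {J : E → FormalMultilinearSeries ℝ E F} {f : E → F}
    (hf : ∀ x ∈ S, (J x 0).curry0 = f x) (h : IsLipJet m ε M J S) : HolderClass ε M m f S := by
  have hb : ∀ x ∈ S, ‖f x‖ ≤ M := fun x hx => IsLipWith.norm_le ⟨J, hf, h⟩ hx
  induction m generalizing F with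
  | zero =>
    refine ⟨hb, fun x hx y hy => ?_⟩
    obtain ⟨-, -, R, hR⟩ := h
    obtain ⟨h3, h4⟩ := hR 0 le_rfl x hx y hy
    have h5 := h3 0
    have h6 : f x - f y = R x y 0 0 := by
      rw [← hf x hx, ← hf y hy, sub_eq_iff_eq_add']
      simpa [ContinuousMultilinearMap.curry0, Subsingleton.elim (padTuple 0 _ _) 0] using h5
    rw [h6]
    have h7 := (R x y 0).le_opNorm 0
    simp only [Finset.univ_eq_empty, Finset.prod_empty, mul_one] at h7
    simpa using h7.trans h4
  | succ m ih =>
    have hd := fun x (hx : x ∈ S) => h.hasFDerivAt hε hS hf hx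
    have hd' : ∀ x ∈ S, (derivJet (J x) 0).curry0 = fderiv ℝ f x := fun x hx => (hd x hx).fderiv.symm
    refine ⟨hb, fun x hx => (hd x hx).differentiableAt.differentiableWithinAt,
      ih hd' h.deriv fun x hx => IsLipWith.norm_le ⟨_, hd', h.deriv⟩ hx⟩

theorem IsLipWith.holderClass (hε : 0 < ε) (hS : IsOpen S) {F : Type u} [NormedAddCommGroup F]
    [NormedSpace ℝ F] {f : E → F} (h : IsLipWith m ε M f S) : HolderClass ε M m f S :=
  let ⟨_, hJ, hJ'⟩ := h
  hJ'.holderClass hε hS hJ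

end Jets

/-! ### Quantitative inverse function theorem near the identity. -/

section Inverse

variable {ε : ℝ}

/-- Bootstrap on `dk = A⁻¹ ∘ k`: if `dk` is of class `m`, then `k` is regular enough for the
right-hand side to be of class `m + 1`. The start is the bound `C₂` on `dk`, which makes `k`
Lipschitz. -/
theorem HolderClass.exists_fderiv_inverse (hε₀ : 0 < ε) (hε₁ : ε ≤ 1) (C₁ C₂ : ℝ) (hC₁ : 0 ≤ C₁)
    (hC₂ : 0 ≤ C₂) (m : ℕ) :
    ∃ K : ℝ, 0 ≤ K ∧ ∀ (E : Type u) [NormedAddCommGroup E] [NormedSpace ℝ E] [CompleteSpace E]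
      (S T : Set E) (A : E → E →L[ℝ] E) (k : E → E), IsOpen S → Convex ℝ S → IsOpen T →
      Convex ℝ T → Set.MapsTo k T S → DifferentiableOn ℝ k T → HolderClass ε C₁ m A S →
      (∀ x ∈ S, IsUnit (A x)) → (∀ x ∈ S, ‖Ring.inverse (A x)‖ ≤ C₂) →
      (∀ y ∈ T, fderiv ℝ k y = Ring.inverse (A (k y))) → HolderClass ε K m (fderiv ℝ k) T := by
  induction m generalizing C₁ with
  | zero =>
    obtain ⟨K₁, hK₁, h₁⟩ := HolderClass.exists_ringInverse.{u} hε₀ hε₁ C₁ C₂ hC₁ hC₂ 0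
    obtain ⟨K₂, hK₂, h₂⟩ := HolderClass.exists_comp.{u} hε₀ hε₁ K₁ C₂ hK₁ hC₂ 0
    refine ⟨K₂, hK₂, fun E _ _ _ S T A k hS hSc hT hTc hk hkd hA hu hb hd => ?_⟩
    refine (h₂ E E (E →L[ℝ] E) T S k _ hT hTc hS hk (h₁ E (E →L[ℝ] E) S A hS hSc hA hu hb)
      ⟨fun x hx y hy => ?_, by simp⟩).congr hT hd
    exact hTc.norm_image_sub_le_of_norm_fderiv_le
      (fun z hz => (hkd z hz).differentiableAt (hT.mem_nhds hz))
      (fun z hz => by rw [hd z hz]; exact hb _ (hk hz)) hy hx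
  | succ m ih =>
    obtain ⟨K, hK, h⟩ := ih (2 * C₁) (by positivity)
    obtain ⟨K₁, hK₁, h₁⟩ := HolderClass.exists_ringInverse.{u} hε₀ hε₁ C₁ C₂ hC₁ hC₂ (m + 1)
    obtain ⟨K₂, hK₂, h₂⟩ := HolderClass.exists_comp.{u} hε₀ hε₁ K₁ K hK₁ hK (m + 1)
    refine ⟨K₂, hK₂, fun E _ _ _ S T A k hS hSc hT hTc hk hkd hA hu hb hd => ?_⟩
    have h3 := h E S T A k hS hSc hT hTc hk hkd (hA.of_succ hε₀ hε₁ hS hSc) hu hb hd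
    exact (h₂ E E (E →L[ℝ] E) T S k _ hT hTc hS hk (h₁ E (E →L[ℝ] E) S A hS hSc hA hu hb)
      (LipClass.of_fderiv hT hTc hkd h3)).congr hT hd

theorem isUnit_of_norm_sub_one_le {R : Type*} [NormedRing R] [CompleteSpace R] {A : R}
    (hA : ‖A - 1‖ ≤ 1 / 4) : IsUnit A := by
  have : ‖1 - A‖ < 1 := by
    rw [norm_sub_rev]
    linarith
  simpa using isUnit_one_sub_of_norm_lt_one this

/-- From `A⁻¹ = 1 - (A - 1) A⁻¹`. The norm of `1` is only bounded by 1, because it vanishes for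
operators on a trivial space. -/
theorem norm_ringInverse_le {R : Type*} [NormedRing R] [CompleteSpace R] (h1 : ‖(1 : R)‖ ≤ 1)
    {A : R} (hA : ‖A - 1‖ ≤ 1 / 4) : ‖Ring.inverse A‖ ≤ 2 := by
  have h2 : Ring.inverse A = 1 - (A - 1) * Ring.inverse A := by
    rw [sub_mul, Ring.mul_inverse_cancel _ (isUnit_of_norm_sub_one_le hA)]
    simp
  have h3 : ‖Ring.inverse A‖ ≤ ‖(1 : R)‖ + ‖(A - 1) * Ring.inverse A‖ :=
    (congrArg norm h2).trans_le (norm_sub_le _ _)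
  have h4 := norm_mul_le (A - 1) (Ring.inverse A)
  nlinarith [norm_nonneg (Ring.inverse A)]

/-- A map whose derivative is close to the identity is invertible, on balls of explicit size, and
the derivative of the inverse is of the same class. -/
theorem exists_local_inverse (hε₀ : 0 < ε) (hε₁ : ε ≤ 1) (C : ℝ) (hC : 0 ≤ C) (m : ℕ) :
    ∃ K : ℝ, 0 ≤ K ∧ ∀ (E : Type u) [NormedAddCommGroup E] [NormedSpace ℝ E] [CompleteSpace E]
      (x₀ : E) (α : ℝ) (h : E → E), 0 < α → h x₀ = 0 → DifferentiableOn ℝ h (Metric.ball x₀ α) →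
      HolderClass ε C m (fderiv ℝ h) (Metric.ball x₀ α) →
      (∀ x ∈ Metric.ball x₀ α, ‖fderiv ℝ h x - 1‖ ≤ 1 / 4) →
      (∀ x ∈ Metric.ball x₀ α, ‖h x‖ ≤ 5 / 4 * ‖x - x₀‖) ∧
      ∃ k : E → E, Set.MapsTo k (Metric.ball 0 (2 * α / 3)) (Metric.ball x₀ α) ∧
        (∀ y ∈ Metric.ball (0 : E) (2 * α / 3), h (k y) = y) ∧
        (∀ x ∈ Metric.ball x₀ α, k (h x) = x) ∧
        DifferentiableOn ℝ k (Metric.ball 0 (2 * α / 3)) ∧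
        HolderClass ε K m (fderiv ℝ k) (Metric.ball 0 (2 * α / 3)) := by
  obtain ⟨K, hK, hK'⟩ := HolderClass.exists_fderiv_inverse.{u} hε₀ hε₁ C 2 hC zero_le_two m
  refine ⟨K, hK, fun E _ _ _ x₀ α h hα hx₀ hd hh hclose => ?_⟩
  have hdiff : ∀ x ∈ Metric.ball x₀ α, DifferentiableAt ℝ h x := fun x hx =>
    (hd x hx).differentiableAt (Metric.isOpen_ball.mem_nhds hx)
  have happrox : ∀ x ∈ Metric.ball x₀ α, ∀ y ∈ Metric.ball x₀ α,
      ‖h x - h y - (x - y)‖ ≤ 1 / 4 * ‖x - y‖ := fun x hx y hy => by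
    simpa using (convex_ball x₀ α).norm_image_sub_le_of_norm_fderiv_le' hdiff hclose hy hx
  refine ⟨fun x hx => ?_, ?_⟩
  · have h1 := happrox x hx x₀ (Metric.mem_ball_self hα)
    have h2 := norm_add_le (h x - h x₀ - (x - x₀)) (x - x₀)
    rw [sub_add_cancel, hx₀, sub_zero] at h2
    rw [hx₀, sub_zero] at h1
    linarith
  have hA : ApproximatesLinearOn h ((ContinuousLinearEquiv.refl ℝ E : E ≃L[ℝ] E) : E →L[ℝ] E)
      (Metric.ball x₀ α) (1 / 4) := fun x hx y hy => by
    simpa using happrox x hx y hy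
  have hN : ∀ [Nontrivial E], ‖((ContinuousLinearEquiv.refl ℝ E).symm : E →L[ℝ] E)‖₊ = 1 := by
    intro _
    ext
    simp
  have hc : Subsingleton E ∨
      (1 / 4 : NNReal) < ‖((ContinuousLinearEquiv.refl ℝ E).symm : E →L[ℝ] E)‖₊⁻¹ := by
    rcases subsingleton_or_nontrivial E with hE | hE
    · exact Or.inl hE
    · right
      rw [hN, inv_one, ← NNReal.coe_lt_coe]
      norm_num
  set P := hA.toOpenPartialHomeomorph h _ hc Metric.isOpen_ball with hP
  have hsource : P.source = Metric.ball x₀ α := rfl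
  have htarget : Metric.ball 0 (2 * α / 3) ⊆ P.target := by
    rcases subsingleton_or_nontrivial E with hE | hE
    · intro y _
      rw [Subsingleton.elim y (P x₀)]
      exact P.map_source (hsource ▸ Metric.mem_ball_self hα)
    -- The image of a closed ball of radius `8α/9 < α` contains the ball of radius `(1 - 1/4) *
    -- (8α/9) = 2α/3`.
    · have h1 := hA.closedBall_subset_target hc Metric.isOpen_ball (b := x₀) (ε := 8 * α / 9)
        (by positivity) (Metric.closedBall_subset_ball (by linarith))
      rw [hN, hx₀] at h1
      refine (Metric.ball_subset_closedBall.trans (Metric.closedBall_subset_closedBall ?_)).trans h1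
      push_cast
      linarith
  have hmaps : Set.MapsTo P.symm (Metric.ball 0 (2 * α / 3)) (Metric.ball x₀ α) := fun y hy =>
    P.map_target (htarget hy)
  have hu : ∀ x ∈ Metric.ball x₀ α, IsUnit (fderiv ℝ h x) := fun x hx =>
    isUnit_of_norm_sub_one_le (hclose x hx)
  have hk : ∀ y ∈ Metric.ball (0 : E) (2 * α / 3),
      HasFDerivAt P.symm (Ring.inverse (fderiv ℝ h (P.symm y))) y := by
    intro y hy
    obtain ⟨u, hu'⟩ := hu _ (hmaps hy)
    rw [← hu', Ring.inverse_unit]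
    have h2 : HasFDerivAt P ((ContinuousLinearEquiv.unitsEquiv ℝ E u : E ≃L[ℝ] E) : E →L[ℝ] E)
        (P.symm y) := by
      have : ((ContinuousLinearEquiv.unitsEquiv ℝ E u : E ≃L[ℝ] E) : E →L[ℝ] E)
        = fderiv ℝ h (P.symm y) := hu' ▸ rfl
      rw [this]
      exact (hdiff _ (hmaps hy)).hasFDerivAt
    exact P.hasFDerivAt_symm (htarget hy) h2
  refine ⟨P.symm, hmaps, fun y hy => P.right_inv (htarget hy), fun x hx => P.left_inv hx,
    fun y hy => (hk y hy).differentiableAt.differentiableWithinAt, ?_⟩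
  exact hK' E (Metric.ball x₀ α) (Metric.ball 0 (2 * α / 3)) (fderiv ℝ h) P.symm
    Metric.isOpen_ball (convex_ball _ _) Metric.isOpen_ball (convex_ball _ _) hmaps
    (fun y hy => (hk y hy).differentiableAt.differentiableWithinAt) hh hu
    (fun x hx => norm_ringInverse_le ContinuousLinearMap.norm_id_le (hclose x hx))
    (fun y hy => (hk y hy).fderiv)

end Inverse

/-! ### Straightening the selected components in the source. -/

section Straightening

variable {E G : Type u} [NormedAddCommGroup E] [NormedSpace ℝ E] [NormedAddCommGroup G]
  [NormedSpace ℝ G]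

/-- The map which replaces the component `π (S (x - x₀))` of `S (x - x₀)` by `u x - u x₀`. -/
def straighten (S : E ≃L[ℝ] E) (π : E →L[ℝ] G) (e : G →L[ℝ] E) (u : E → G) (x₀ x : E) : E :=
  e (u x - u x₀) + (S (x - x₀) - e (π (S (x - x₀))))

theorem proj_straighten {S : E ≃L[ℝ] E} {π : E →L[ℝ] G} {e : G →L[ℝ] E} (hπe : ∀ v, π (e v) = v)
    (u : E → G) (x₀ x : E) : π (straighten S π e u x₀ x) = u x - u x₀ := by
  simp [straighten, hπe]

theorem straighten_self (S : E ≃L[ℝ] E) (π : E →L[ℝ] G) (e : G →L[ℝ] E) (u : E → G) (x₀ : E) :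
    straighten S π e u x₀ x₀ = 0 := by
  simp [straighten]

theorem hasFDerivAt_straighten (S : E ≃L[ℝ] E) (π : E →L[ℝ] G) (e : G →L[ℝ] E) {u : E → G}
    (x₀ : E) {x : E} (hu : DifferentiableAt ℝ u x) :
    HasFDerivAt (straighten S π e u x₀) (e ∘L fderiv ℝ u x +
      ((S : E →L[ℝ] E) - e ∘L π ∘L (S : E →L[ℝ] E))) x := by
  have h1 : HasFDerivAt (fun x => e (u x - u x₀)) (e ∘L fderiv ℝ u x) x :=
    e.hasFDerivAt.comp x (hu.hasFDerivAt.sub_const _)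
  have h2 : HasFDerivAt (fun x => ((S : E →L[ℝ] E) - e ∘L π ∘L (S : E →L[ℝ] E)) (x - x₀))
      ((S : E →L[ℝ] E) - e ∘L π ∘L (S : E →L[ℝ] E)) x := by
    have := ((S : E →L[ℝ] E) - e ∘L π ∘L (S : E →L[ℝ] E)).hasFDerivAt.comp x
      ((hasFDerivAt_id x).sub_const x₀)
    simpa [Function.comp_def] using this
  exact h1.add h2

/-- Up to `S`, the operator is block triangular: the selected minor and the identity on the
diagonal, the rest of `B` off it. Back substitution gives the inverse; the 2's in the bound come
from the norm of `P`, the complementary projection. -/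
theorem exists_equiv_of_minor {S : E ≃L[ℝ] E} {π : E →L[ℝ] G} {e : G →L[ℝ] E}
    (hπe : ∀ v, π (e v) = v) (hS : ‖(S.symm : E →L[ℝ] E)‖ ≤ 1) (hπ : ‖π‖ ≤ 1) (he : ‖e‖ ≤ 1)
    {B : E →L[ℝ] G} {N : G →L[ℝ] G} (hN₁ : ∀ v, B (S.symm (e (N v))) = v)
    (hN₂ : ∀ v, N (B (S.symm (e v))) = v) {M₁ M₂ : ℝ} (hB : ‖B‖ ≤ M₁) (hN : ‖N‖ ≤ M₂) :
    ∃ L : E ≃L[ℝ] E, (L : E →L[ℝ] E) = e ∘L B + ((S : E →L[ℝ] E) - e ∘L π ∘L (S : E →L[ℝ] E)) ∧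
      ‖(L.symm : E →L[ℝ] E)‖ ≤ M₂ * (1 + M₁ * 2) + 2 := by
  have hM₁ : 0 ≤ M₁ := (norm_nonneg _).trans hB
  have hM₂ : 0 ≤ M₂ := (norm_nonneg _).trans hN
  set P : E →L[ℝ] E := ContinuousLinearMap.id ℝ E - e ∘L π with hP
  have hP' : ∀ y, ‖P y‖ ≤ 2 * ‖y‖ := fun y => by
    have h1 : ‖e (π y)‖ ≤ 1 * (1 * ‖y‖) :=
      e.le_of_opNorm_le_of_le he (π.le_of_opNorm_le hπ y)
    have h2 : ‖P y‖ ≤ ‖y‖ + ‖e (π y)‖ := norm_sub_le _ _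
    linarith
  refine ⟨ContinuousLinearEquiv.equivOfInverse
    (e ∘L B + ((S : E →L[ℝ] E) - e ∘L π ∘L (S : E →L[ℝ] E)))
    ((S.symm : E →L[ℝ] E) ∘L (e ∘L N ∘L (π - B ∘L (S.symm : E →L[ℝ] E) ∘L P) + P))
    (fun x => ?_) (fun y => ?_), ?_, ?_⟩
  · simp only [hP, ContinuousLinearMap.comp_apply, _root_.add_apply, _root_.sub_apply,
      ContinuousLinearEquiv.coe_coe, ContinuousLinearMap.id_apply, map_add, map_sub, hπe,
      sub_self, add_zero, ContinuousLinearEquiv.symm_apply_apply, hN₂]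
    abel
  · simp only [hP, ContinuousLinearMap.comp_apply, _root_.add_apply, _root_.sub_apply,
      ContinuousLinearEquiv.coe_coe, ContinuousLinearMap.id_apply, map_add, map_sub, hπe,
      sub_self, add_zero, ContinuousLinearEquiv.apply_symm_apply, hN₁]
    abel
  · ext x
    rfl
  · refine ContinuousLinearMap.opNorm_le_bound _ (by positivity) fun y => ?_
    have h1 : ‖B (S.symm (P y))‖ ≤ M₁ * (1 * (2 * ‖y‖)) :=
      B.le_of_opNorm_le_of_le hB ((S.symm : E →L[ℝ] E).le_of_opNorm_le_of_le hS (hP' y))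
    have h2 : ‖π y - B (S.symm (P y))‖ ≤ 1 * ‖y‖ + M₁ * (1 * (2 * ‖y‖)) :=
      (norm_sub_le _ _).trans (add_le_add (π.le_of_opNorm_le hπ y) h1)
    have h3 := e.le_of_opNorm_le_of_le he (N.le_of_opNorm_le_of_le hN h2)
    have h4 := (S.symm : E →L[ℝ] E).le_of_opNorm_le_of_le hS
      ((norm_add_le _ _).trans (add_le_add h3 (hP' y)))
    refine (le_of_eq ?_).trans (h4.trans (le_of_eq ?_))
    · rfl
    · ring

/-- Quantitative straightening: all constants depend only on `ε`, `M₁`, `M₂` and `m`. -/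
theorem exists_straightening {ε : ℝ} (hε₀ : 0 < ε) (hε₁ : ε ≤ 1) (M₁ M₂ : ℝ) (hM₁ : 0 ≤ M₁)
    (hM₂ : 0 ≤ M₂) (m : ℕ) :
    ∃ δ Λ K : ℝ, 0 < δ ∧ 0 ≤ Λ ∧ 0 ≤ K ∧ ∀ (E : Type u) [NormedAddCommGroup E] [NormedSpace ℝ E]
      [CompleteSpace E] (G : Type u) [NormedAddCommGroup G] [NormedSpace ℝ G] (S : E ≃L[ℝ] E)
      (π : E →L[ℝ] G) (e : G →L[ℝ] E) (N : G →L[ℝ] G) (u : E → G) (x₀ : E) (α : ℝ),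
      (∀ v, π (e v) = v) → ‖(S : E →L[ℝ] E)‖ ≤ 1 → ‖(S.symm : E →L[ℝ] E)‖ ≤ 1 → ‖π‖ ≤ 1 →
      ‖e‖ ≤ 1 → (∀ v, fderiv ℝ u x₀ (S.symm (e (N v))) = v) →
      (∀ v, N (fderiv ℝ u x₀ (S.symm (e v))) = v) → ‖N‖ ≤ M₂ → 0 < α → α ≤ δ →
      DifferentiableOn ℝ u (Metric.ball x₀ α) →
      HolderClass ε M₁ m (fderiv ℝ u) (Metric.ball x₀ α) →
      ∃ (L : E ≃L[ℝ] E) (k : E → E), ‖(L.symm : E →L[ℝ] E)‖ ≤ Λ ∧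
        (∀ x ∈ Metric.ball x₀ α, ‖L.symm (straighten S π e u x₀ x)‖ ≤ 5 / 4 * ‖x - x₀‖) ∧
        Set.MapsTo k (Metric.ball 0 (2 * α / 3)) (Metric.ball x₀ α) ∧
        (∀ y ∈ Metric.ball (0 : E) (2 * α / 3), straighten S π e u x₀ (k y) = L y) ∧
        (∀ x ∈ Metric.ball x₀ α, k (L.symm (straighten S π e u x₀ x)) = x) ∧
        DifferentiableOn ℝ k (Metric.ball 0 (2 * α / 3)) ∧
        HolderClass ε K m (fderiv ℝ k) (Metric.ball 0 (2 * α / 3)) ∧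
        DifferentiableOn ℝ (straighten S π e u x₀) (Metric.ball x₀ α) ∧
        ∃ C, HolderClass ε C m (fderiv ℝ (straighten S π e u x₀)) (Metric.ball x₀ α) := by
  set Λ : ℝ := M₂ * (1 + M₁ * 2) + 2 with hΛ
  have hΛ0 : 0 < Λ := by positivity
  obtain ⟨K₀, hK₀, h₀⟩ := HolderClass.exists_zero.{u} ε hε₀ hε₁ m
  obtain ⟨K, hK, h₁⟩ := exists_local_inverse.{u} hε₀ hε₁ (Λ * (1 * M₁ + 2)) (by positivity) m
  -- Chosen so that `Λ * (K₀ * M₁ + 1) * δ ^ ε = 1 / 4`; the `+ 1` keeps the denominator positive.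
  set δ : ℝ := (1 / (4 * (Λ * (K₀ * M₁ + 1)))) ^ (1 / ε) with hδ
  refine ⟨δ, Λ, K, by positivity, hΛ0.le, hK, fun E _ _ _ G _ _ S π e N u x₀ α hπe hS hS' hπ he hN₁
    hN₂ hN hα hαδ hud huh => ?_⟩
  have hx₀ := Metric.mem_ball_self (x := x₀) hα
  obtain ⟨L, hL, hL'⟩ := exists_equiv_of_minor hπe hS' hπ he hN₁ hN₂ (huh.norm_le x₀ hx₀) hN
  set f := straighten S π e u x₀ with hf
  have hfd : ∀ x ∈ Metric.ball x₀ α, HasFDerivAt f (e ∘L fderiv ℝ u x +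
      ((S : E →L[ℝ] E) - e ∘L π ∘L (S : E →L[ℝ] E))) x := fun x hx =>
    hasFDerivAt_straighten S π e x₀ ((hud x hx).differentiableAt (Metric.isOpen_ball.mem_nhds hx))
  have hfh : HolderClass ε (1 * M₁ + 2) m (fderiv ℝ f) (Metric.ball x₀ α) := by
    have h2 := huh.clm_comp Metric.isOpen_ball (ContinuousLinearMap.compL ℝ E G E e)
      ((e.norm_compL_apply_le E).trans he)
    have h3 : ‖(S : E →L[ℝ] E) - e ∘L π ∘L (S : E →L[ℝ] E)‖ ≤ 2 := by
      have h4 := e.opNorm_comp_le (π ∘L (S : E →L[ℝ] E))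
      have h5 := π.opNorm_comp_le (S : E →L[ℝ] E)
      have h6 : ‖π‖ * ‖(S : E →L[ℝ] E)‖ ≤ 1 := mul_le_one₀ hπ (norm_nonneg _) hS
      have h7 : ‖e‖ * ‖π ∘L (S : E →L[ℝ] E)‖ ≤ 1 :=
        mul_le_one₀ he (norm_nonneg _) (h5.trans h6)
      linarith [norm_sub_le (S : E →L[ℝ] E) (e ∘L π ∘L (S : E →L[ℝ] E))]
    exact (h2.add Metric.isOpen_ball (HolderClass.const zero_le_two _ h3)).congr
      Metric.isOpen_ball fun x hx => (hfd x hx).fderiv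
  have hhd : ∀ x ∈ Metric.ball x₀ α, HasFDerivAt (fun x => L.symm (f x))
      ((L.symm : E →L[ℝ] E) ∘L fderiv ℝ f x) x := fun x hx => by
    rw [(hfd x hx).fderiv]
    exact (L.symm : E →L[ℝ] E).hasFDerivAt.comp x (hfd x hx)
  have hhh : HolderClass ε (Λ * (1 * M₁ + 2)) m (fderiv ℝ fun x => L.symm (f x))
      (Metric.ball x₀ α) :=
    (hfh.clm_comp Metric.isOpen_ball
      (ContinuousLinearMap.compL ℝ E E E (L.symm : E →L[ℝ] E))
      (((L.symm : E →L[ℝ] E).norm_compL_apply_le E).trans hL')).congr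
      Metric.isOpen_ball fun x hx => (hhd x hx).fderiv
  have hclose : ∀ x ∈ Metric.ball x₀ α, ‖fderiv ℝ (fun x => L.symm (f x)) x - 1‖ ≤ 1 / 4 := by
    intro x hx
    -- The constant linear part of `f` cancels, so only the variation of `fderiv ℝ u` remains.
    have h2 : fderiv ℝ (fun x => L.symm (f x)) x - 1
        = (L.symm : E →L[ℝ] E) ∘L (e ∘L (fderiv ℝ u x - fderiv ℝ u x₀)) := by
      rw [(hhd x hx).fderiv, (hfd x hx).fderiv]
      have h3 : (1 : E →L[ℝ] E) = (L.symm : E →L[ℝ] E) ∘L (L : E →L[ℝ] E) := by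
        ext v
        simp
      rw [h3, hL, ← ContinuousLinearMap.comp_sub, add_sub_add_right_eq_sub,
        ← ContinuousLinearMap.comp_sub]
    have h4 := (h₀ M₁ E (E →L[ℝ] G) _ _ Metric.isOpen_ball (convex_ball _ _) huh).2 x hx x₀ hx₀
    have h5 : ‖x - x₀‖ ^ ε ≤ 1 / (4 * (Λ * (K₀ * M₁ + 1))) := by
      have h6 : ‖x - x₀‖ ≤ δ := (mem_ball_iff_norm.1 hx).le.trans hαδ
      refine (Real.rpow_le_rpow (norm_nonneg _) h6 hε₀.le).trans (le_of_eq ?_)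
      rw [hδ, ← Real.rpow_mul (by positivity), one_div_mul_cancel hε₀.ne', Real.rpow_one]
    have h7 : ‖fderiv ℝ u x - fderiv ℝ u x₀‖
        ≤ (K₀ * M₁ + 1) * (1 / (4 * (Λ * (K₀ * M₁ + 1)))) := by
      refine h4.trans (mul_le_mul (by linarith) h5 (by positivity) (by positivity))
    rw [h2]
    have h8 : ‖e ∘L (fderiv ℝ u x - fderiv ℝ u x₀)‖ ≤
        1 * ((K₀ * M₁ + 1) * (1 / (4 * (Λ * (K₀ * M₁ + 1))))) :=
      (e.opNorm_comp_le _).trans (mul_le_mul he h7 (norm_nonneg _) zero_le_one)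
    refine ((L.symm : E →L[ℝ] E).opNorm_comp_le _).trans
      ((mul_le_mul hL' h8 (norm_nonneg _) hΛ0.le).trans (le_of_eq ?_))
    have h9 : (K₀ * M₁ + 1) ≠ 0 := by positivity
    have h10 : M₂ * (1 + M₁ * 2) + 2 ≠ 0 := hΛ0.ne'
    rw [hΛ]
    field_simp
  obtain ⟨h2, k, hk₁, hk₂, hk₃, hk₄, hk₅⟩ := h₁ E x₀ α (fun x => L.symm (f x)) hα
    (by simp [hf, straighten_self]) (fun x hx => (hhd x hx).differentiableAt.differentiableWithinAt)
    hhh hclose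
  refine ⟨L, k, hL', h2, hk₁, fun y hy => ?_, hk₃, hk₄, hk₅,
    fun x hx => (hfd x hx).differentiableAt.differentiableWithinAt, _, hfh⟩
  rw [← hk₂ y hy, L.apply_symm_apply, hk₂ y hy]

end Straightening

/-! ### Constant rank, descent along the projection, flattening of the target. -/

section ConstantRank

variable {E F G : Type u} [NormedAddCommGroup E] [NormedSpace ℝ E] [NormedAddCommGroup F]
  [NormedSpace ℝ F] [NormedAddCommGroup G] [NormedSpace ℝ G] {ε : ℝ} {m : ℕ}

/-- `Q` maps the range of `D` onto `G`, whose dimension is at least that of the range, so `Q` is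
injective there. -/
theorem LinearMap.apply_eq_zero_of_finrank_range_le {E F G : Type*} [AddCommGroup E] [Module ℝ E]
    [AddCommGroup F] [Module ℝ F] [AddCommGroup G] [Module ℝ G] [FiniteDimensional ℝ F]
    (D : E →ₗ[ℝ] F) (Q : F →ₗ[ℝ] G) (hsurj : Function.Surjective (Q ∘ₗ D))
    (hrank : Module.finrank ℝ (LinearMap.range D) ≤ Module.finrank ℝ G) {v : E}
    (hv : Q (D v) = 0) : D v = 0 := by
  set Q' : LinearMap.range D →ₗ[ℝ] G := Q.domRestrict (LinearMap.range D) with hQ'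
  have hs : Function.Surjective Q' := fun w => by
    obtain ⟨x, hx⟩ := hsurj w
    exact ⟨⟨D x, x, rfl⟩, hx⟩
  have hG : FiniteDimensional ℝ G := Module.Finite.of_surjective Q' hs
  have hle : Module.finrank ℝ G ≤ Module.finrank ℝ (LinearMap.range D) :=
    LinearMap.finrank_le_finrank_of_surjective hs
  have hi : Function.Injective Q' :=
    (LinearMap.injective_iff_surjective_of_finrank_eq_finrank (le_antisymm hrank hle)).2 hs
  have := hi (a₁ := ⟨D v, v, rfl⟩) (a₂ := 0) (by rw [map_zero]; exact hv)
  exact congrArg Subtype.val this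

/-- A map of constant rank whose component `Q ∘ Φ` is a submersive linear projection (up to a
constant) depends only on this component. -/
theorem eq_of_proj_eq [FiniteDimensional ℝ F] {H : Set E} (hH : IsOpen H) (hconv : Convex ℝ H)
    {Φ : E → F} (hΦ : DifferentiableOn ℝ Φ H)
    (hrank : ∀ y ∈ H, Module.finrank ℝ (LinearMap.range (fderiv ℝ Φ y).toLinearMap)
      ≤ Module.finrank ℝ G) {π : E →L[ℝ] G} (hπ : Function.Surjective π) {Q : F →L[ℝ] G} {c : G}
    (hQ : ∀ y ∈ H, Q (Φ y) = c + π y) {y z : E} (hy : y ∈ H) (hz : z ∈ H) (hyz : π y = π z) :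
    Φ y = Φ z := by
  have hd : ∀ x ∈ H, HasFDerivAt Φ (fderiv ℝ Φ x) x := fun x hx =>
    ((hΦ x hx).differentiableAt (hH.mem_nhds hx)).hasFDerivAt
  have hcomp : ∀ x ∈ H, Q ∘L fderiv ℝ Φ x = π := fun x hx => by
    have h1 : HasFDerivAt (fun y => Q (Φ y)) (Q ∘L fderiv ℝ Φ x) x :=
      Q.hasFDerivAt.comp x (hd x hx)
    have h2 : HasFDerivAt (fun y => Q (Φ y)) π x :=
      (π.hasFDerivAt.const_add c).congr_of_eventuallyEq
        (Filter.eventuallyEq_of_mem (hH.mem_nhds hx) hQ)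
    exact h1.unique h2
  -- `z - y` lies in the kernel of `π = Q ∘ dΦ`, hence in that of `dΦ` by the rank condition; so `Φ`
  -- is constant on the segment, which stays in `H` by convexity.
  have hzero : ∀ x ∈ H, fderiv ℝ Φ x (z - y) = 0 := fun x hx => by
    refine LinearMap.apply_eq_zero_of_finrank_range_le (fderiv ℝ Φ x).toLinearMap
      Q.toLinearMap ?_ (hrank x hx) ?_
    · intro w
      obtain ⟨v, hv⟩ := hπ w
      exact ⟨v, (congrArg (fun A => A v) (hcomp x hx)).trans hv⟩
    · refine (congrArg (fun A => A (z - y)) (hcomp x hx)).trans ?_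
      rw [map_sub, hyz, sub_self]
  have hder : ∀ t ∈ Set.Icc (0 : ℝ) 1,
      HasDerivWithinAt (fun t : ℝ => Φ (y + t • (z - y))) 0 (Set.Icc 0 1) t := fun t ht => by
    have h1 : HasDerivAt (fun t : ℝ => y + t • (z - y)) (z - y) t := by
      simpa using ((hasDerivAt_id t).smul_const (z - y)).const_add y
    have hm := hconv.add_smul_sub_mem hy hz ht
    have h2 := (hd _ hm).comp_hasDerivAt t h1
    rw [hzero _ hm] at h2
    exact h2.hasDerivWithinAt
  have h3 := norm_image_sub_le_of_norm_deriv_le_segment_01' hder (C := 0)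
    fun t _ => by simp
  simp only [one_smul, zero_smul, add_zero, add_sub_cancel, norm_le_zero_iff] at h3
  exact (sub_eq_zero.1 h3).symm

theorem HolderClass.of_fderiv {C B : ℝ} {S : Set E} {f : E → F} (hf : DifferentiableOn ℝ f S)
    (h : HolderClass ε C m (fderiv ℝ f) S) (hB : ∀ x ∈ S, ‖f x‖ ≤ B) :
    HolderClass ε (max B C) (m + 1) f S :=
  ⟨fun x hx => (hB x hx).trans (le_max_left _ _), hf, h.mono_const (le_max_right _ _)⟩

/-- A map which depends only on `π y` descends to a map of the same class. -/
theorem exists_descent (hε₀ : 0 < ε) (hε₁ : ε ≤ 1) {H H' : Set E} (hH' : IsOpen H')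
    {Φ : E → F} {C : ℝ} (hC : 0 ≤ C) (hΦ : HolderClass ε C (m + 1) Φ H')
    {π : E →L[ℝ] G} {e : G →L[ℝ] E} (hπe : ∀ v, π (e v) = v)
    (heq : ∀ y ∈ H', ∀ z ∈ H', π y = π z → Φ y = Φ z) {ρ : ℝ} (hρ : 0 < ρ)
    (hHH : ∀ y ∈ H, ∀ d : G, ‖d‖ < ρ → y + e d ∈ H') :
    ∃ Ψ : G → F, (∀ y ∈ H', Ψ (π y) = Φ y) ∧ ∃ C', 0 ≤ C' ∧ HolderClass ε C' (m + 1) Ψ (π '' H) := by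
  classical
  set Ψ : G → F := fun v => if hv : ∃ y ∈ H', π y = v then Φ hv.choose else 0 with hΨ
  have h1 : ∀ y ∈ H', Ψ (π y) = Φ y := fun y hy => by
    have hv : ∃ z ∈ H', π z = π y := ⟨y, hy, rfl⟩
    simp only [hΨ, dif_pos hv]
    exact heq _ hv.choose_spec.1 _ hy hv.choose_spec.2
  obtain ⟨K, hK, hK'⟩ := HolderClass.exists_comp.{u} hε₀ hε₁ C ‖e‖ hC (norm_nonneg _) (m + 1)
  refine ⟨Ψ, h1, _, by positivity, HolderClass.of_local hε₀ hρ hK ?_⟩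
  rintro _ ⟨y, hy, rfl⟩
  -- The affine section of `π` through `y` lifts a ball of uniform radius into `H'`, where `Ψ` is
  -- `Φ` composed with this section. The margin between `H` and `H'` is what makes `of_local`
  -- applicable.
  have hmem : ∀ v ∈ Metric.ball (π y) ρ, e v + (y - e (π y)) ∈ H' := fun v hv => by
    have := hHH y hy (v - π y) (by rwa [← mem_ball_iff_norm])
    rw [map_sub] at this
    convert this using 1
    abel
  refine (hK' G E F (Metric.ball (π y) ρ) H' _ Φ Metric.isOpen_ball (convex_ball _ _) hH' hmem hΦ
    (LipClass.affine Metric.isOpen_ball (convex_ball _ _) (norm_nonneg _) e le_rfl _)).congr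
    Metric.isOpen_ball fun v hv => ?_
  rw [← h1 _ (hmem v hv)]
  simp [hπe]

theorem Convex.preimage_sub_const {F G : Type*} [NormedAddCommGroup F] [NormedSpace ℝ F]
    [NormedAddCommGroup G] [NormedSpace ℝ G] {H : Set G} (hH : Convex ℝ H) (Q : F →L[ℝ] G)
    (c : G) : Convex ℝ ((fun w => Q w - c) ⁻¹' H) := by
  intro x hx y hy a b ha hb hab
  have h1 := hH hx hy ha hb hab
  change Q (a • x + b • y) - c ∈ H
  convert h1 using 1
  have h2 : c = a • c + b • c := by rw [← add_smul, hab, one_smul]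
  nth_rewrite 1 [h2]
  simp only [map_add, map_smul, smul_sub]
  abel

/-- The shear of the target space which flattens the graph of `Ψ`. -/
def flatten (T : F ≃L[ℝ] F) (π : F →L[ℝ] G) (e : G →L[ℝ] F) (Ψ : G → F) (c : G) (w : F) : F :=
  T (w - Ψ (π (T w) - c)) + e (π (T w) - c)

/-- The inverse of `flatten`. -/
def unflatten (T : F ≃L[ℝ] F) (π : F →L[ℝ] G) (e : G →L[ℝ] F) (Ψ : G → F) (z : F) : F :=
  T.symm (z - e (π z)) + Ψ (π z)

section Flatten

variable {T : F ≃L[ℝ] F} {π : F →L[ℝ] G} {e : G →L[ℝ] F} {Ψ : G → F} {c : G} {H : Set G} {C : ℝ}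

/-- `hΨ` makes `Ψ` a section of `w ↦ π (T w) - c`, so the shear preserves this parameter; hence
`unflatten` can recover which `Ψ` value was subtracted. -/
theorem proj_flatten (hπe : ∀ v, π (e v) = v) (hΨ : ∀ v ∈ H, π (T (Ψ v)) = c + v) {w : F}
    (hw : π (T w) - c ∈ H) : π (flatten T π e Ψ c w) = π (T w) - c := by
  simp only [flatten, map_add, map_sub, hπe]
  rw [hΨ _ hw]
  abel

theorem isDiffeo_flatten (hε₀ : 0 < ε) (hH : IsOpen H) (hπe : ∀ v, π (e v) = v)
    (hΨ : ∀ v ∈ H, π (T (Ψ v)) = c + v) (hΨC : HolderClass ε C (m + 1) Ψ H) :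
    IsDiffeo (m + 1) (flatten T π e Ψ c) (unflatten T π e Ψ) ((fun w => π (T w) - c) ⁻¹' H)
      (π ⁻¹' H) := by
  have hcd := hΨC.contDiffOn hε₀ hH
  have hinv : ∀ z, π z ∈ H → π (T (unflatten T π e Ψ z)) - c = π z := fun z hz => by
    simp only [unflatten, map_add, ContinuousLinearEquiv.apply_symm_apply, hΨ _ hz]
    simp [hπe]
  have hu : ContDiff ℝ ((m + 1 : ℕ) : WithTop ℕ∞) fun w => π (T w) - c :=
    (π.contDiff.comp T.contDiff).sub contDiff_const
  refine ⟨hH.preimage hu.continuous, hH.preimage π.continuous, fun w hw => ?_, fun z hz => ?_,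
    ⟨fun w hw => ?_, fun z hz => ?_⟩, ?_, ?_⟩
  · change π _ ∈ H
    rw [proj_flatten hπe hΨ hw]
    exact hw
  · change π (T _) - c ∈ H
    rw [hinv z hz]
    exact hz
  · rw [unflatten, proj_flatten hπe hΨ hw]
    simp [flatten]
  · rw [flatten, hinv z hz]
    simp [unflatten]
  · exact (T.contDiff.comp_contDiffOn (contDiffOn_id.sub (hcd.comp hu.contDiffOn fun w hw => hw))).add
      (e.contDiff.comp hu).contDiffOn
  · exact (T.symm.contDiff.comp (contDiff_id.sub (e.contDiff.comp π.contDiff))).contDiffOn.add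
      (hcd.comp π.contDiff.contDiffOn fun w hw => hw)

/-- The shear is affine plus a bounded term, on a domain which may be unbounded: its derivative is
controlled globally, its values only on bounded sets. Convexity of the domain, and of its
intersection with a ball, gives access to `HolderClass.isLipWith`. -/
theorem isLip_flatten (hε₀ : 0 < ε) (hε₁ : ε ≤ 1) (hH : IsOpen H) (hconv : Convex ℝ H)
    (hC : 0 ≤ C) (hΨC : HolderClass ε C (m + 1) Ψ H) :
    IsLip m ε (fderiv ℝ (flatten T π e Ψ c)) ((fun w => π (T w) - c) ⁻¹' H) ∧
      ∀ S ⊆ (fun w => π (T w) - c) ⁻¹' H, Bornology.IsBounded S →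
        IsLip (m + 1) ε (flatten T π e Ψ c) S := by
  set W := (fun w => π (T w) - c) ⁻¹' H with hW
  have hu : Continuous fun w => π (T w) - c := (π.continuous.comp T.continuous).sub continuous_const
  have hWo : IsOpen W := hH.preimage hu
  set Q : F →L[ℝ] G := π ∘L (T : F →L[ℝ] F) with hQ
  have hWc : Convex ℝ W := hconv.preimage_sub_const Q c
  set A : F →L[ℝ] F := (T : F →L[ℝ] F) + e ∘L Q with hA
  obtain ⟨K, hK, hK'⟩ := HolderClass.exists_comp.{u} hε₀ hε₁ C ‖Q‖ hC (norm_nonneg _) (m + 1)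
  have h1 : HolderClass ε K (m + 1) (fun w => Ψ (Q w + -c)) W :=
    hK' F G F W H _ Ψ hWo hWc hH (fun w hw => (sub_eq_add_neg (Q w) c) ▸ hw) hΨC
      (LipClass.affine hWo hWc (norm_nonneg _) Q le_rfl _)
  have h2 := (h1.clm_comp hWo (T : F →L[ℝ] F) le_rfl).neg hWo
  set K₁ := ‖(T : F →L[ℝ] F)‖ * K with hK₁
  have hK₁' : 0 ≤ K₁ := by positivity
  have hg : flatten T π e Ψ c = fun w => (A w + -e c) + -(T : F →L[ℝ] F) (Ψ (Q w + -c)) := by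
    ext1 w
    simp only [flatten, hA, hQ, map_sub, ContinuousLinearMap.comp_apply, _root_.add_apply,
      ContinuousLinearEquiv.coe_coe, ← sub_eq_add_neg]
    abel
  have haff : ∀ w, HasFDerivAt (fun w => A w + -e c) A w := fun w => A.hasFDerivAt.add_const _
  have hgd : DifferentiableOn ℝ (flatten T π e Ψ c) W := by
    rw [hg]
    exact DifferentiableOn.add (fun w _ => (haff w).differentiableAt.differentiableWithinAt) h2.2.1
  have hgh : HolderClass ε (‖A‖ + K₁) m (fderiv ℝ (flatten T π e Ψ c)) W := by
    refine ((HolderClass.const (norm_nonneg A) A le_rfl).add hWo h2.2.2).congr hWo fun w hw => ?_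
    rw [hg]
    refine (fderiv_fun_add (haff w).differentiableAt
      ((h2.2.1 w hw).differentiableAt (hWo.mem_nhds hw))).trans ?_
    rw [(haff w).fderiv]
  refine ⟨⟨_, hgh.isLipWith hε₀ hWc hWo⟩, fun S hS hb => ?_⟩
  obtain ⟨R, hR⟩ := hb.subset_ball 0
  have hsub : W ∩ Metric.ball 0 R ⊆ W := Set.inter_subset_left
  have h3 : HolderClass ε (max (‖A‖ * R + ‖e c‖ + K₁) (‖A‖ + K₁)) (m + 1) (flatten T π e Ψ c)
      (W ∩ Metric.ball 0 R) := by
    refine HolderClass.of_fderiv (hgd.mono hsub) (hgh.mono_set hsub) fun w hw => ?_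
    have h4 : ‖w‖ ≤ R := by
      simpa using (Metric.mem_ball.1 hw.2).le
    have h5 := A.le_opNorm_of_le h4
    have h6 := h2.norm_le w hw.1
    have h7 := norm_add_le (A w) (-e c)
    rw [norm_neg] at h7
    rw [hg]
    exact (norm_add_le _ _).trans (by linarith)
  exact ⟨_, (h3.isLipWith hε₀ (hWc.inter (convex_ball _ _))
    (hWo.inter Metric.isOpen_ball)).mono_set (Set.subset_inter hS hR)⟩

end Flatten

end ConstantRank

/-! ### Assembly of the normal form. -/

section NormalForm

/-- The constant rank theorem, in a coordinate-free form. The maps `S` and `T` stand for the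
permutations of the coordinates, the maps `π`, `e`, `π'`, `e'` for the projections on, and the
inclusions of, the first coordinates. -/
theorem exists_normalForm {ε : ℝ} (hε₀ : 0 < ε) (hε₁ : ε ≤ 1) (M₁ M₂ : ℝ) (hM₁ : 0 ≤ M₁)
    (hM₂ : 0 ≤ M₂) (m : ℕ) :
    ∃ δ c : ℝ, 0 < δ ∧ 0 ≤ c ∧ ∀ (E : Type u) [NormedAddCommGroup E] [NormedSpace ℝ E]
      [CompleteSpace E] (F : Type u) [NormedAddCommGroup F] [NormedSpace ℝ F]
      [FiniteDimensional ℝ F] (G : Type u) [NormedAddCommGroup G] [NormedSpace ℝ G]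
      [CompleteSpace G] (S : E ≃L[ℝ] E) (π : E →L[ℝ] G) (e : G →L[ℝ] E)
      (T : F ≃L[ℝ] F) (π' : F →L[ℝ] G) (e' : G →L[ℝ] F) (N : G →L[ℝ] G) (U : Set E) (φ : E → F)
      (x₀ : E) (α : ℝ),
      (∀ v, π (e v) = v) → (∀ v, π' (e' v) = v) → ‖(S : E →L[ℝ] E)‖ ≤ 1 →
      ‖(S.symm : E →L[ℝ] E)‖ ≤ 1 → ‖π‖ ≤ 1 → ‖e‖ ≤ 1 → ‖(T : F →L[ℝ] F)‖ ≤ 1 → ‖π'‖ ≤ 1 →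
      IsOpen U → DifferentiableOn ℝ φ U →
      (∀ x ∈ U, Module.finrank ℝ (LinearMap.range (fderiv ℝ φ x).toLinearMap) =
        Module.finrank ℝ G) →
      HolderClass ε M₁ m (fderiv ℝ φ) U →
      (∀ v, π' (T (fderiv ℝ φ x₀ (S.symm (e (N v))))) = v) →
      (∀ v, N (π' (T (fderiv ℝ φ x₀ (S.symm (e v))))) = v) → ‖N‖ ≤ M₂ →
      0 < α → α ≤ δ → Metric.ball x₀ α ⊆ U →
      ∃ (U₀ H : Set E) (f f' : E → E) (W W' : Set F) (g g' : F → F),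
        IsOpen U₀ ∧ IsOpen H ∧ Metric.ball x₀ (α / 3) ⊆ U₀ ∧ U₀ ⊆ U ∧
        IsLipDiffeo (m + 1) ε f f' U₀ H ∧ f x₀ = 0 ∧
        IsDiffeo (m + 1) g g' W W' ∧ φ '' U₀ ⊆ W ∧ g (φ x₀) = 0 ∧
        IsLip m ε (fderiv ℝ g) W ∧ IsLip (m + 1) ε g (φ '' U₀) ∧
        (∀ S ⊆ W, Bornology.IsBounded S → IsLip (m + 1) ε g S) ∧
        (∀ x ∈ H, g (φ (f' x)) = e' (π x)) ∧
        (Function.Injective π → Set.InjOn φ U₀ ∧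
          ∃ (V : Set F) (ψ : F → E), IsOpen V ∧ φ '' U₀ ⊆ V ∧ Set.LeftInvOn ψ φ U₀ ∧
            IsLip (m + 1) ε ψ V ∧ DifferentiableOn ℝ ψ V ∧ IsLipWith m ε c (fderiv ℝ ψ) V) := by
  obtain ⟨δ, Λ, K, hδ, hΛ, hK, h₁⟩ := exists_straightening.{u} hε₀ hε₁ (1 * M₁) M₂
    (by positivity) hM₂ m
  obtain ⟨K₂, hK₂, h₂⟩ := HolderClass.exists_comp.{u} hε₀ hε₁ K (2 * Λ) hK (by positivity) m
  refine ⟨δ, 2 * 4 ^ m * 1 * K₂ * Λ, hδ, by positivity, fun E _ _ _ F _ _ _ G _ _ _ S π e T π' e' N U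
    φ x₀ α hπe hπe' hS hS' hπ he hT hπ' hU hφ hrank hφh hN₁ hN₂ hN hα hαδ hball => ?_⟩
  set B := Metric.ball x₀ α with hB
  have hBo : IsOpen B := Metric.isOpen_ball
  have hBc : Convex ℝ B := convex_ball _ _
  have hx₀ : x₀ ∈ B := Metric.mem_ball_self hα
  set Q : F →L[ℝ] G := π' ∘L (T : F →L[ℝ] F) with hQ
  have hQ1 : ‖Q‖ ≤ 1 := (π'.opNorm_comp_le _).trans (mul_le_one₀ hπ' (norm_nonneg _) hT)
  set u : E → G := fun x => Q (φ x) with hu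
  have hφd : ∀ x ∈ B, DifferentiableAt ℝ φ x := fun x hx =>
    (hφ x (hball hx)).differentiableAt (hU.mem_nhds (hball hx))
  have hud : ∀ x ∈ B, HasFDerivAt u (Q ∘L fderiv ℝ φ x) x := fun x hx =>
    Q.hasFDerivAt.comp x (hφd x hx).hasFDerivAt
  have huh : HolderClass ε (1 * M₁) m (fderiv ℝ u) B :=
    ((hφh.mono_set hball).clm_comp hBo (ContinuousLinearMap.compL ℝ E F G Q)
      ((Q.norm_compL_apply_le E).trans hQ1)).congr hBo fun x hx => (hud x hx).fderiv
  obtain ⟨L, k, hL, hfb, hkm, hfk, hkf, hkd, hkh, hfd, Cf, hfh⟩ := h₁ E G S π e N u x₀ α hπe hS hS' hπ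
    he (by rw [(hud x₀ hx₀).fderiv]; exact hN₁) (by rw [(hud x₀ hx₀).fderiv]; exact hN₂) hN hα hαδ
    (fun x hx => (hud x hx).differentiableAt.differentiableWithinAt) huh
  set f := straighten S π e u x₀ with hf
  have hπf : ∀ x, π (f x) = u x - u x₀ := proj_straighten hπe u x₀
  have hπs : Function.Surjective π := fun v => ⟨e v, hπe v⟩
  -- The inverse exists over radius `2α/3`. The radius `α/2` leaves a margin `α/6` for the descent
  -- and still covers the image of `B(x₀, α/3)`, as `5/4 * α/3 < α/2`.
  set H' : Set E := L.symm ⁻¹' Metric.ball 0 (2 * α / 3) with hH'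
  set H : Set E := L.symm ⁻¹' Metric.ball 0 (α / 2) with hH
  have hH'o : IsOpen H' := Metric.isOpen_ball.preimage L.symm.continuous
  have hHo : IsOpen H := Metric.isOpen_ball.preimage L.symm.continuous
  have hH'c : Convex ℝ H' := (convex_ball _ _).linear_preimage (L.symm : E →L[ℝ] E).toLinearMap
  have hHc : Convex ℝ H := (convex_ball _ _).linear_preimage (L.symm : E →L[ℝ] E).toLinearMap
  have hHH' : H ⊆ H' := Set.preimage_mono (Metric.ball_subset_ball (by linarith))
  set f' : E → E := fun y => k (L.symm y) with hf'
  have hff' : ∀ y ∈ H', f (f' y) = y := fun y hy => by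
    rw [hf', hfk _ hy, L.apply_symm_apply]
  set U₀ : Set E := B ∩ (fun x => L.symm (f x)) ⁻¹' Metric.ball 0 (α / 2) with hU₀
  have hU₀B : U₀ ⊆ B := Set.inter_subset_left
  have hmaps : Set.MapsTo f U₀ H := fun x hx => hx.2
  have hφb : ∀ x ∈ B, ‖φ x‖ ≤ ‖φ x₀‖ + M₁ * α := fun x hx => by
    have h3 := hBc.norm_image_sub_le_of_norm_fderiv_le hφd
      (fun z hz => hφh.norm_le z (hball hz)) hx₀ hx
    have h4 : M₁ * ‖x - x₀‖ ≤ M₁ * α := by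
      gcongr
      exact (mem_ball_iff_norm.1 hx).le
    have h5 := norm_le_norm_add_norm_sub' (φ x) (φ x₀)
    linarith
  -- Constants involving `φ x₀` or `x₀` are harmless for `f`, `f'` and `g`, for which only the
  -- existence of a constant is claimed.
  have hφc : HolderClass ε (max (‖φ x₀‖ + M₁ * α) M₁) (m + 1) φ B :=
    HolderClass.of_fderiv (hφ.mono hball) (hφh.mono_set hball) hφb
  have hkb : ∀ y ∈ Metric.ball (0 : E) (2 * α / 3), ‖k y‖ ≤ ‖x₀‖ + α := fun y hy => by
    have h3 := (mem_ball_iff_norm.1 (hkm hy)).le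
    have h5 := norm_le_norm_add_norm_sub' (k y) x₀
    linarith
  obtain ⟨Cf', hCf', h₃⟩ := HolderClass.exists_comp.{u} hε₀ hε₁ (max (‖x₀‖ + α) K)
    ‖(L.symm : E →L[ℝ] E)‖ (by positivity) (norm_nonneg _) (m + 1)
  have hf'c : HolderClass ε Cf' (m + 1) f' H' := by
    refine (h₃ E E E H' (Metric.ball 0 (2 * α / 3)) (fun y => L.symm y + 0) k hH'o hH'c
      Metric.isOpen_ball (fun y hy => ?_) (HolderClass.of_fderiv hkd hkh hkb) ?_).congr hH'o ?_
    · change L.symm y + 0 ∈ _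
      rw [add_zero]
      exact hy
    · exact LipClass.affine hH'o hH'c (norm_nonneg _) (L.symm : E →L[ℝ] E) le_rfl 0
    · intro y _
      simp [hf']
  have hfc : HolderClass ε (max (‖(L : E →L[ℝ] E)‖ * (5 / 4 * α)) Cf) (m + 1) f B := by
    refine HolderClass.of_fderiv hfd hfh fun x hx => ?_
    have h3 := (L : E →L[ℝ] E).le_opNorm_of_le ((hfb x hx).trans
      (mul_le_mul_of_nonneg_left (mem_ball_iff_norm.1 hx).le (by norm_num)))
    simpa using h3
  set Φ : E → F := fun y => φ (f' y) with hΦ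
  have hf'm : Set.MapsTo f' H' B := fun y hy => hkm hy
  obtain ⟨CΦ, hCΦ, h₄⟩ := HolderClass.exists_comp.{u} hε₀ hε₁ (max (‖φ x₀‖ + M₁ * α) M₁) Cf'
    (by positivity) hCf' (m + 1)
  have hΦc : HolderClass ε CΦ (m + 1) Φ H' :=
    h₄ E E F H' B f' φ hH'o hH'c hBo hf'm hφc (hf'c.lipClass hH'o hH'c)
  have hQΦ : ∀ y ∈ H', Q (Φ y) = u x₀ + π y := fun y hy => by
    have h3 := hπf (f' y)
    rw [hff' y hy] at h3
    rw [h3, add_sub_cancel]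
  have hΦd : ∀ y ∈ H', HasFDerivAt Φ (fderiv ℝ φ (f' y) ∘L fderiv ℝ f' y) y := fun y hy =>
    (hφd _ (hf'm hy)).hasFDerivAt.comp y
      ((hf'c.2.1 y hy).differentiableAt (hH'o.mem_nhds hy)).hasFDerivAt
  have heq : ∀ y ∈ H', ∀ z ∈ H', π y = π z → Φ y = Φ z := by
    refine fun y hy z hz => eq_of_proj_eq hH'o hH'c hΦc.2.1 (fun y hy => ?_) hπs hQΦ hy hz
    -- Composition with the derivative of `f'` cannot raise the rank, and an upper bound is enough.
    rw [(hΦd y hy).fderiv, ← hrank _ (hball (hf'm hy))]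
    exact Submodule.finrank_mono (LinearMap.range_comp_le_range _ _)
  obtain ⟨Ψ, hΨ, CΨ, hCΨ, hΨc⟩ := exists_descent (H := H) hε₀ hε₁ hH'o hCΦ hΦc hπe heq
    -- For `‖d‖ < ρ`, `‖L.symm (e d)‖ ≤ Λ * ‖d‖ < α / 6`, the margin between `H` and `H'`.
    (ρ := α / (6 * (Λ + 1))) (by positivity) (fun y hy d hd => by
      have h3 : ‖L.symm (e d)‖ ≤ Λ * (1 * ‖d‖) :=
        (L.symm : E →L[ℝ] E).le_of_opNorm_le_of_le hL (e.le_of_opNorm_le he d)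
      have h4 : ‖d‖ * (6 * (Λ + 1)) < α := (lt_div_iff₀ (by positivity)).1 hd
      have h5 : ‖L.symm y‖ < α / 2 := mem_ball_zero_iff.1 hy
      have h6 := norm_add_le (L.symm y) (L.symm (e d))
      refine mem_ball_zero_iff.2 ?_
      rw [map_add]
      nlinarith [norm_nonneg d])
  set H₁ : Set G := π '' H with hH₁
  have hH₁o : IsOpen H₁ := π.isOpenMap hπs H hHo
  have hH₁c : Convex ℝ H₁ := hHc.linear_image π.toLinearMap
  have hQΨ : ∀ v ∈ H₁, π' (T (Ψ v)) = u x₀ + v := by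
    rintro _ ⟨y, hy, rfl⟩
    rw [hΨ y (hHH' hy)]
    exact hQΦ y (hHH' hy)
  obtain ⟨hg₁, hg₂⟩ := isLip_flatten (T := T) (π := π') (e := e') (c := u x₀) hε₀ hε₁ hH₁o hH₁c hCΨ
    hΨc
  set W : Set F := (fun w => π' (T w) - u x₀) ⁻¹' H₁ with hW
  have hsub : φ '' U₀ ⊆ W := by
    rintro _ ⟨x, hx, rfl⟩
    exact ⟨f x, hmaps hx, hπf x⟩
  have hf0 : f x₀ = 0 := straighten_self S π e u x₀
  have h0 : (0 : E) ∈ H' := by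
    simp only [hH', Set.mem_preimage, map_zero]
    exact Metric.mem_ball_self (by positivity)
  have hf'0 : f' 0 = x₀ := by
    have := hkf x₀ hx₀
    rwa [hf0] at this
  refine ⟨U₀, H, f, f', W, π' ⁻¹' H₁, flatten T π' e' Ψ (u x₀), unflatten T π' e' Ψ, ?_, hHo, ?_,
    hU₀B.trans hball, ⟨hmaps, ?_, ⟨?_, ?_⟩, ?_, ?_⟩, hf0,
    isDiffeo_flatten hε₀ hH₁o hπe' hQΨ hΨc, hsub, ?_, hg₁, hg₂ _ hsub ?_, hg₂, ?_, ?_⟩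
  · exact ContinuousOn.isOpen_inter_preimage
      (L.symm.continuous.comp_continuousOn hfd.continuousOn) hBo Metric.isOpen_ball
  · intro x hx
    have hxB : x ∈ B := Metric.ball_subset_ball (by linarith) hx
    refine ⟨hxB, mem_ball_zero_iff.2 ?_⟩
    have h3 := hfb x hxB
    have h4 := mem_ball_iff_norm.1 hx
    linarith
  · intro y hy
    refine ⟨hf'm (hHH' hy), ?_⟩
    change L.symm (f (f' y)) ∈ Metric.ball 0 (α / 2)
    rw [hff' y (hHH' hy)]
    exact hy
  · exact fun x hx => hkf x hx.1
  · exact fun y hy => hff' y (hHH' hy)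
  · exact ⟨_, (hfc.isLipWith hε₀ hBc hBo).mono_set hU₀B⟩
  · exact ⟨_, (hf'c.isLipWith hε₀ hH'c hH'o).mono_set hHH'⟩
  · have h3 : Ψ 0 = φ x₀ := by
      rw [← map_zero π, hΨ 0 h0, hΦ]
      exact congrArg φ hf'0
    have h4 : π' (T (φ x₀)) - u x₀ = 0 := sub_self _
    simp [flatten, h4, h3]
  · refine (Metric.isBounded_iff_subset_closedBall 0).2 ⟨‖φ x₀‖ + M₁ * α, ?_⟩
    rintro _ ⟨x, hx, rfl⟩
    exact mem_closedBall_zero_iff.2 (hφb x (hU₀B hx))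
  · intro y hy
    have h3 : π' (T (Φ y)) - u x₀ = π y := by
      rw [sub_eq_iff_eq_add']
      exact hQΦ y (hHH' hy)
    change flatten T π' e' Ψ (u x₀) (Φ y) = _
    rw [flatten, h3, hΨ y (hHH' hy), sub_self, map_zero, zero_add]
  · intro hinj
    -- With `π` injective, `e` inverts it, so `f x` can be read off from `Q (φ x)`. The left inverse
    -- is `k` after an affine map of slope at most `Λ`; the constant of its derivative thus involves
    -- only `K` and `Λ`.
    have heπ : ∀ y, e (π y) = y := fun y => hinj (hπe _)
    set A : F →L[ℝ] E := (L.symm : E →L[ℝ] E) ∘L e ∘L Q with hA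
    have hA' : ‖A‖ ≤ Λ := by
      have h3 : ‖e ∘L Q‖ ≤ 1 := (e.opNorm_comp_le Q).trans (mul_le_one₀ he (norm_nonneg _) hQ1)
      calc ‖A‖ ≤ ‖(L.symm : E →L[ℝ] E)‖ * ‖e ∘L Q‖ := ContinuousLinearMap.opNorm_comp_le _ _
        _ ≤ Λ * 1 := mul_le_mul hL h3 (norm_nonneg _) hΛ
        _ = Λ := mul_one Λ
    set a : F → E := fun w => A w + -L.symm (e (u x₀)) with ha
    have ha' : ∀ w, a w = L.symm (e (Q w - u x₀)) := fun w => by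
      simp [ha, hA, sub_eq_add_neg]
    have hWo : IsOpen W := (isDiffeo_flatten hε₀ hH₁o hπe' hQΨ hΨc).isOpen_source
    have hWc : Convex ℝ W := hH₁c.preimage_sub_const Q (u x₀)
    have ham : Set.MapsTo a W (Metric.ball 0 (2 * α / 3)) := by
      intro w hw
      obtain ⟨y, hy, hyw⟩ := hw
      rw [ha' w, show Q w - u x₀ = π y from hyw.symm, heπ]
      exact hHH' hy
    have had : ∀ w, HasFDerivAt a A w := fun w => A.hasFDerivAt.add_const _
    have hal : LipClass ε Λ (m + 1) a W := LipClass.affine hWo hWc hΛ A hA' _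
    have hψh := (h₂ F E (E →L[ℝ] E) W _ a _ hWo hWc Metric.isOpen_ball ham hkh
      (hal.of_succ hε₀ hε₁ hΛ hWo hWc)).fderiv_comp hε₀ hε₁ hWo hWc Metric.isOpen_ball hkd
      (fun w _ => (had w).differentiableAt.differentiableWithinAt) ham (hal.2 m rfl).2
    have hψd : DifferentiableOn ℝ (fun w => k (a w)) W :=
      hkd.comp (fun w _ => (had w).differentiableAt.differentiableWithinAt) ham
    refine ⟨fun x hx z hz hxz => ?_, W, fun w => k (a w), hWo, hsub, fun x hx => ?_, ?_, hψd,
      hψh.isLipWith hε₀ hWc hWo⟩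
    · have h3 : f x = f z := hinj (by rw [hπf, hπf, hu]; simp only [hxz])
      rw [← hkf x hx.1, ← hkf z hz.1, h3]
    · change k (a (φ x)) = x
      rw [ha', show Q (φ x) - u x₀ = π (f x) from (hπf x).symm, heπ]
      exact hkf x hx.1
    · exact ⟨_, (HolderClass.of_fderiv hψd hψh fun w hw => hkb _ (ham hw)).isLipWith hε₀ hWc hWo⟩

end NormalForm

/-! ### Permutations, projections and inclusions of coordinates. -/

section Coordinates

variable {p q k : ℕ}

/-- The permutation of the coordinates `x ↦ x ∘ σ`. -/
noncomputable def permCoords (σ : Equiv.Perm (Fin p)) : (Fin p → ℝ) ≃L[ℝ] (Fin p → ℝ) :=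
  (LinearEquiv.funCongrLeft ℝ ℝ σ).toContinuousLinearEquiv

theorem permCoords_apply (σ : Equiv.Perm (Fin p)) (x : Fin p → ℝ) (a : Fin p) :
    permCoords σ x a = x (σ a) := rfl

/-- The projection on the first `k` coordinates. -/
noncomputable def takeCoords (h : k ≤ p) : (Fin p → ℝ) →L[ℝ] (Fin k → ℝ) :=
  LinearMap.toContinuousLinearMap (LinearMap.funLeft ℝ ℝ (Fin.castLE h))

theorem takeCoords_apply (h : k ≤ p) (x : Fin p → ℝ) (a : Fin k) :
    takeCoords h x a = x (Fin.castLE h a) := rfl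

/-- The inclusion of the first `k` coordinates. -/
noncomputable def padCoords (k p : ℕ) : (Fin k → ℝ) →L[ℝ] (Fin p → ℝ) :=
  LinearMap.toContinuousLinearMap
    { toFun := fun v a => if ha : a.1 < k then v ⟨a.1, ha⟩ else 0
      map_add' := fun v w => by
        ext a
        by_cases ha : a.1 < k <;> simp [ha]
      map_smul' := fun c v => by
        ext a
        by_cases ha : a.1 < k <;> simp [ha] }

theorem padCoords_apply (v : Fin k → ℝ) (a : Fin p) :
    padCoords k p v a = if ha : a.1 < k then v ⟨a.1, ha⟩ else 0 := rfl

theorem opNorm_le_one_of_coords (A : (Fin p → ℝ) →L[ℝ] (Fin q → ℝ))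
    (hA : ∀ x a, ‖A x a‖ ≤ ‖x‖) : ‖A‖ ≤ 1 :=
  A.opNorm_le_bound zero_le_one fun x => by
    rw [one_mul]
    exact (pi_norm_le_iff_of_nonneg (norm_nonneg _)).2 (hA x)

theorem norm_permCoords_le (σ : Equiv.Perm (Fin p)) :
    ‖(permCoords σ : (Fin p → ℝ) →L[ℝ] (Fin p → ℝ))‖ ≤ 1 :=
  opNorm_le_one_of_coords _ fun x a => norm_le_pi_norm x (σ a)

theorem norm_permCoords_symm_le (σ : Equiv.Perm (Fin p)) :
    ‖((permCoords σ).symm : (Fin p → ℝ) →L[ℝ] (Fin p → ℝ))‖ ≤ 1 :=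
  opNorm_le_one_of_coords _ fun x a => norm_le_pi_norm x (σ.symm a)

theorem norm_takeCoords_le (h : k ≤ p) : ‖takeCoords h‖ ≤ 1 :=
  opNorm_le_one_of_coords _ fun x a => norm_le_pi_norm x (Fin.castLE h a)

theorem norm_padCoords_le (k p : ℕ) : ‖padCoords k p‖ ≤ 1 :=
  opNorm_le_one_of_coords _ fun v a => by
    rw [padCoords_apply]
    split_ifs with ha
    · exact norm_le_pi_norm v _
    · simp

theorem takeCoords_padCoords (h : k ≤ p) (v : Fin k → ℝ) : takeCoords h (padCoords k p v) = v := by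
  ext a
  rw [takeCoords_apply, padCoords_apply, dif_pos (by simp)]
  rfl

theorem padCoords_takeCoords (h : k ≤ p) (x : Fin p → ℝ) :
    padCoords k q (takeCoords h x) = firstCoords p q k x := by
  ext a
  rw [padCoords_apply, firstCoords]
  by_cases ha : a.1 < k
  · rw [dif_pos ha, dif_pos ⟨ha, ha.trans_le h⟩]
    rfl
  · rw [dif_neg ha, dif_neg fun h => ha h.1]

theorem permCoords_symm_padCoords (h : k ≤ p) (σ : Equiv.Perm (Fin p)) (v : Fin k → ℝ) :
    (permCoords σ).symm (padCoords k p v)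
      = ∑ l, v l • (Pi.single (σ (Fin.castLE h l)) 1 : Fin p → ℝ) := by
  rw [ContinuousLinearEquiv.symm_apply_eq]
  ext a
  rw [permCoords_apply, padCoords_apply, Finset.sum_apply]
  simp only [Pi.smul_apply, Pi.single_apply, smul_eq_mul, mul_ite, mul_one, mul_zero,
    EmbeddingLike.apply_eq_iff_eq]
  split_ifs with ha
  · rw [Finset.sum_eq_single ⟨a.1, ha⟩, if_pos (show a = Fin.castLE h ⟨a.1, ha⟩ from rfl)]
    · intro l _ hl
      rw [if_neg]
      rintro rfl
      exact hl rfl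
    · simp
  · refine (Finset.sum_eq_zero fun l _ => if_neg ?_).symm
    rintro rfl
    exact ha l.2

/-- Identifies the minor with the block inverted by `N` in `exists_normalForm`. -/
theorem jacobianMinor_mulVec (hp : k ≤ p) (hq : k ≤ q) {φ : (Fin p → ℝ) → (Fin q → ℝ)}
    {x : Fin p → ℝ} {i : Fin k → Fin q} {j : Fin k → Fin p} {σ : Equiv.Perm (Fin p)}
    {τ : Equiv.Perm (Fin q)} (hσ : ∀ l, σ (Fin.castLE hp l) = j l)
    (hτ : ∀ r, τ (Fin.castLE hq r) = i r) (v : Fin k → ℝ) :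
    takeCoords hq (permCoords τ (fderiv ℝ φ x ((permCoords σ).symm (padCoords k p v))))
      = (jacobianMinor φ x i j).mulVec v := by
  ext r
  rw [takeCoords_apply, permCoords_apply, hτ, permCoords_symm_padCoords hp, map_sum,
    Finset.sum_apply, Matrix.mulVec, dotProduct]
  refine Finset.sum_congr rfl fun l _ => ?_
  rw [map_smul, hσ, Pi.smul_apply, smul_eq_mul, mul_comm]
  rfl

/-- Evaluate on the vector of ones, of norm 1 because `k ≥ 1`; every coordinate map has norm at most
1. This lower bound on `‖D‖` converts an absolute bound into one proportional to the norm of the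
derivative. -/
theorem one_le_mul_norm_of_leftInverse (hq : k ≤ q) (hk : 1 ≤ k) {σ : Equiv.Perm (Fin p)}
    {τ : Equiv.Perm (Fin q)} {D : (Fin p → ℝ) →L[ℝ] (Fin q → ℝ)}
    {N : (Fin k → ℝ) →L[ℝ] (Fin k → ℝ)}
    (hN : ∀ v, N (takeCoords hq (permCoords τ (D ((permCoords σ).symm (padCoords k p v))))) = v)
    {M₂ : ℝ} (hM₂ : ‖N‖ ≤ M₂) : 1 ≤ M₂ * ‖D‖ := by
  have : Nonempty (Fin k) := ⟨⟨0, hk⟩⟩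
  set v : Fin k → ℝ := fun _ => 1 with hv
  have hv1 : ‖v‖ = 1 := by simp [hv]
  have h1 : ‖padCoords k p v‖ ≤ 1 * 1 :=
    (padCoords k p).le_of_opNorm_le_of_le (norm_padCoords_le k p) hv1.le
  have h2 : ‖(permCoords σ).symm (padCoords k p v)‖ ≤ 1 * (1 * 1) :=
    ContinuousLinearMap.le_of_opNorm_le_of_le _ (norm_permCoords_symm_le σ) h1
  have h3 := D.le_opNorm_of_le h2
  have h4 : ‖permCoords τ (D ((permCoords σ).symm (padCoords k p v)))‖ ≤ 1 * _ :=
    ContinuousLinearMap.le_of_opNorm_le_of_le _ (norm_permCoords_le τ) h3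
  have h5 := N.le_of_opNorm_le_of_le hM₂
    ((takeCoords hq).le_of_opNorm_le_of_le (norm_takeCoords_le hq) h4)
  rw [hN v, hv1] at h5
  linarith

end Coordinates

/-! ### The Lip norm as an infimum, and the theorem in coordinates. -/

theorem nonempty_lipConst {E F : Type} [NormedAddCommGroup E] [NormedSpace ℝ E]
    [NormedAddCommGroup F] [NormedSpace ℝ F] {m : ℕ} {ε : ℝ} {f : E → F} {U : Set E} {x₀ : E}
    (hx₀ : x₀ ∈ U) (hf : IsLip m ε f U) : {M : ℝ | 0 ≤ M ∧ IsLipWith m ε M f U}.Nonempty :=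
  let ⟨M, hM⟩ := hf
  ⟨M, (norm_nonneg _).trans (hM.norm_le hx₀), hM⟩

theorem norm_le_lipNorm {E F : Type} [NormedAddCommGroup E] [NormedSpace ℝ E]
    [NormedAddCommGroup F] [NormedSpace ℝ F] {m : ℕ} {ε : ℝ} {f : E → F} {U : Set E} {x₀ : E}
    (hx₀ : x₀ ∈ U) (hf : IsLip m ε f U) : ‖f x₀‖ ≤ lipNorm m ε f U :=
  le_csInf (nonempty_lipConst hx₀ hf) fun _ hM => hM.2.norm_le hx₀

theorem lipNorm_le {E F : Type} [NormedAddCommGroup E] [NormedSpace ℝ E]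
    [NormedAddCommGroup F] [NormedSpace ℝ F] {m : ℕ} {ε C : ℝ} {f : E → F} {U : Set E}
    (hC : 0 ≤ C) (hf : IsLipWith m ε C f U) : lipNorm m ε f U ≤ C :=
  csInf_le ⟨0, fun _ hM => hM.1⟩ ⟨hC, hf⟩

theorem mainTheorem8 (n : ℕ) (hn : 1 ≤ n) (ε : ℝ) (hε₀ : 0 < ε) (hε₁ : ε ≤ 1)
    (M₁ M₂ : ℝ) (hM₁ : 0 < M₁) (hM₂ : 0 < M₂) :
    ∃ δ c : ℝ, 0 < δ ∧ 0 < c ∧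
      ∀ (p q k : ℕ), 1 ≤ p → 1 ≤ q →
      ∀ (U : Set (Fin p → ℝ)) (φ : (Fin p → ℝ) → (Fin q → ℝ)) (x₀ : Fin p → ℝ)
        (i : Fin k → Fin q) (j : Fin k → Fin p),
        IsOpen U → x₀ ∈ U →
        DifferentiableOn ℝ φ U →
        (∀ x ∈ U, Module.finrank ℝ (LinearMap.range (fderiv ℝ φ x).toLinearMap) = k) →
        IsLip (n - 1) ε (fderiv ℝ φ) U →
        StrictMono i → StrictMono j →
        IsUnit (jacobianMinor φ x₀ i j) →
        lipNorm (n - 1) ε (fderiv ℝ φ) U ≤ M₁ →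
        subordinateNorm (jacobianMinor φ x₀ i j)⁻¹ ≤ M₂ →
        ∀ α : ℝ, 0 < α → α ≤ δ → closure (Metric.ball x₀ α) ⊆ U →
        ∃ (U₀ H : Set (Fin p → ℝ)) (f f' : (Fin p → ℝ) → (Fin p → ℝ))
          (W W' : Set (Fin q → ℝ)) (g g' : (Fin q → ℝ) → (Fin q → ℝ)),
          -- the diffeomorphism `f : U₀ → H`, with inverse `f'`
          IsOpen U₀ ∧ IsOpen H ∧ Metric.ball x₀ (α / 3) ⊆ U₀ ∧ U₀ ⊆ U ∧
          IsLipDiffeo n ε f f' U₀ H ∧ f x₀ = 0 ∧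
          -- the diffeomorphism `g : W → W'`, with inverse `g'`
          IsDiffeo n g g' W W' ∧ φ '' U₀ ⊆ W ∧ g (φ x₀) = 0 ∧
          IsLip (n - 1) ε (fderiv ℝ g) W ∧
          IsLip n ε g (φ '' U₀) ∧
          (∀ S ⊆ W, Bornology.IsBounded S → IsLip n ε g S) ∧
          -- the normal form
          (∀ x ∈ H, g (φ (f' x)) = firstCoords p q k x) ∧
          -- the case of maximal rank `k = p`
          (k = p →
            Set.InjOn φ U₀ ∧
            (∀ x ∈ U₀, Function.Injective (fderiv ℝ φ x)) ∧
            ∃ (V : Set (Fin q → ℝ)) (ψ : (Fin q → ℝ) → (Fin p → ℝ)),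
              IsOpen V ∧ φ '' U₀ ⊆ V ∧
              Set.LeftInvOn ψ φ U₀ ∧
              IsLip n ε ψ V ∧
              DifferentiableOn ℝ ψ V ∧
              IsLip (n - 1) ε (fderiv ℝ ψ) V ∧
              lipNorm (n - 1) ε (fderiv ℝ ψ) V ≤
                c * lipNorm (n - 1) ε (fderiv ℝ φ) U) := by
  obtain ⟨m, rfl⟩ : ∃ m, n = m + 1 := ⟨n - 1, by omega⟩
  simp only [Nat.add_sub_cancel]
  -- `M₁ + 1` leaves room to pick an admissible constant near the infimum without showing that it is
  -- attained.
  obtain ⟨δ, c, hδ, hc, h⟩ := exists_normalForm.{0} hε₀ hε₁ (M₁ + 1) M₂ (by positivity) hM₂.le m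
  -- `c * M₂` suffices for the estimate; the `+ 1` ensures positivity.
  refine ⟨δ, c * M₂ + 1, hδ, by positivity, ?_⟩
  intro p q k _ _ U φ x₀ i j hU hx₀ hφ hrank hlip hi hj hunit hM₁' hM₂' α hα hαδ hball
  have hp : k ≤ p := by simpa using Fintype.card_le_of_injective j hj.injective
  have hq : k ≤ q := by simpa using Fintype.card_le_of_injective i hi.injective
  -- The selected indices are moved to the first `k` places by permutations of the coordinates.
  obtain ⟨σ, hσ⟩ := Equiv.Perm.exists_extending_pair (Fin.castLE hp) j
    (Fin.castLE_injective hp) hj.injective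
  obtain ⟨τ, hτ⟩ := Equiv.Perm.exists_extending_pair (Fin.castLE hq) i
    (Fin.castLE_injective hq) hi.injective
  obtain ⟨M, ⟨hM0, hM⟩, hMlt⟩ := exists_lt_of_csInf_lt (nonempty_lipConst hx₀ hlip)
    (hM₁'.trans_lt (lt_add_one M₁))
  have hφh : HolderClass ε (M₁ + 1) m (fderiv ℝ φ) U :=
    (hM.mono_const hMlt.le).holderClass hε₀ hU
  have hdet : IsUnit (jacobianMinor φ x₀ i j).det := (Matrix.isUnit_iff_isUnit_det _).1 hunit
  set N : (Fin k → ℝ) →L[ℝ] (Fin k → ℝ) :=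
    LinearMap.toContinuousLinearMap (Matrix.toLin' (jacobianMinor φ x₀ i j)⁻¹) with hN
  have hNv : ∀ v, N v = (jacobianMinor φ x₀ i j)⁻¹.mulVec v := fun v => Matrix.toLin'_apply _ v
  have hN₁ : ∀ v, takeCoords hq (permCoords τ (fderiv ℝ φ x₀
      ((permCoords σ).symm (padCoords k p (N v))))) = v := fun v => by
    rw [jacobianMinor_mulVec hp hq hσ hτ, hNv, Matrix.mulVec_mulVec, Matrix.mul_nonsing_inv _ hdet,
      Matrix.one_mulVec]
  have hN₂ : ∀ v, N (takeCoords hq (permCoords τ (fderiv ℝ φ x₀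
      ((permCoords σ).symm (padCoords k p v))))) = v := fun v => by
    rw [jacobianMinor_mulVec hp hq hσ hτ, hNv, Matrix.mulVec_mulVec, Matrix.nonsing_inv_mul _ hdet,
      Matrix.one_mulVec]
  obtain ⟨U₀, H, f, f', W, W', g, g', h₁, h₂, h₃, h₄, h₅, h₆, h₇, h₈, h₉, h₁₀, h₁₁, h₁₂, h₁₃, h₁₄⟩ :=
    h (Fin p → ℝ) (Fin q → ℝ) (Fin k → ℝ) (permCoords σ) (takeCoords hp) (padCoords k p)
      (permCoords τ) (takeCoords hq) (padCoords k q) N U φ x₀ α (takeCoords_padCoords hp)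
      (takeCoords_padCoords hq) (norm_permCoords_le σ) (norm_permCoords_symm_le σ)
      (norm_takeCoords_le hp) (norm_padCoords_le k p) (norm_permCoords_le τ) (norm_takeCoords_le hq)
      hU hφ (fun x hx => by rw [hrank x hx, Module.finrank_fin_fun]) hφh hN₁ hN₂ hM₂' hα hαδ
      (subset_closure.trans hball)
  refine ⟨U₀, H, f, f', W, W', g, g', h₁, h₂, h₃, h₄, h₅, h₆, h₇, h₈, h₉, h₁₀, h₁₁, h₁₂,
    fun x hx => ?_, fun hkp => ?_⟩
  · rw [h₁₃ x hx, padCoords_takeCoords hp]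
  subst hkp
  obtain ⟨h₁₅, V, ψ, h₁₆, h₁₇, h₁₈, h₁₉, h₂₀, h₂₁⟩ := h₁₄ fun x y hxy => funext fun a =>
    congrFun hxy a
  refine ⟨h₁₅, fun x hx => ?_, V, ψ, h₁₆, h₁₇, h₁₈, h₁₉, h₂₀, ⟨c, h₂₁⟩, ?_⟩
  -- Rank-nullity: full rank `p` leaves a trivial kernel.
  · have h₂₂ := LinearMap.finrank_range_add_finrank_ker (fderiv ℝ φ x).toLinearMap
    rw [hrank x (h₄ hx), Module.finrank_fin_fun] at h₂₂
    exact LinearMap.ker_eq_bot.1 (Submodule.finrank_eq_zero.1 (by omega))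
  · have hA := norm_le_lipNorm hx₀ hlip
    set D := fderiv ℝ φ x₀ with hD
    -- Here `k = p ≥ 1`, so the minor is not empty.
    have hone := one_le_mul_norm_of_leftInverse hq (by omega) hN₂ hM₂'
    have h₂₄ : 1 ≤ M₂ * lipNorm m ε (fderiv ℝ φ) U :=
      hone.trans (mul_le_mul_of_nonneg_left hA hM₂.le)
    have h₂₅ := mul_le_mul_of_nonneg_left h₂₄ hc
    have h₂₆ := (norm_nonneg _).trans hA
    exact (lipNorm_le hc h₂₁).trans (by linarith)
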